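/- Let $(U_k)_{k\ge 0}$ be i.i.d. uniform random variables on $[-1,1]$, realized as the coordinates of the canonical product probability space $\Omega$. For $n\ge 1$ let $\hat L^2(\mathbb R_+^n)$ be the space of symmetric square-integrable functions $f_n:\mathbb R_+^n\to\mathbb R$ that vanish (a.e.) outside of $$\Delta_n=\bigcup_{k_1,\dots,k_n\ge 0\ \text{pairwise distinct}}[2k_1,2k_1+2]\times\cdots\times[2k_n,2k_n+2].$$ For $f_n\in\hat L^2(\mathbb R_+^n)\cap L^1(\mathbb R_+^n)$ the multiple stochastic integral is $$I_n(f_n)=\sum_{r=0}^n\frac{(-1)^{n-r}}{2^{n-r}}\binom nr\sum_{k_1,\dots,k_r\ge 0\ \text{pairwise distinct}}\int_{\mathbb R_+^{n-r}}f_n(2k_1+1+U_{k_1},\dots,2k_r+1+U_{k_r},y_1,\dots,y_{n-r})\,dy_1\cdots dy_{n-r},$$ and it is extended to all $f_n\in\hat L^2(\mathbb R_+^n)$ by $L^2$-continuity: $I_n(f_n)$ is the limit in $L^2(\Omega)$ of $I_n(g_m)$ for $g_m\in\hat L^2(\mathbb R_+^n)\cap L^1(\mathbb R_+^n)$ with $g_m\to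 f_n$ in $L^2(\mathbb R_+^n)$; this limit exists and is almost surely unique. For a random variable $X$ on $\Omega$ and $t\ge 0$ put $$\nabla_tX=X\circ\Psi_t-\frac12\int_{2\lfloor t/2\rfloor}^{2\lfloor t/2\rfloor+2}X\circ\Psi_s\,ds,$$ where $\Psi_t:\Omega\to\Omega$ replaces the coordinate $U_{\lfloor t/2\rfloor}$ by $t-2\lfloor t/2\rfloor-1$ and keeps all the others. Let $d_W(X,\mathcal N)=\sup_h|E[h(X)]-E[h(N)]|$, where $N$ is standard normal and $h$ runs over the functions $\mathbb R\to\mathbb R$ with Lipschitz constant at most $1$. **Proposition.** Let $n\ge1$ and $f_n\in\hat L^2(\mathbb R_+^n)$. Then $t\mapsto\nabla_tI_n(f_n)$ is almost surely in $L^2(\mathbb R_+)$, and $$\begin{aligned}d_W(I_n(f_n),\mathcal N)\le{}&\sqrt{E\Big[\Big(1-\frac1n\|\nabla I_n(f_n)\|^2_{L^2(\mathbb R_+,dx/2)}\Big)^2\Big]}+\frac1{2n}E\Big[\int_0^\infty|\nabla_tI_n(f_n)|^3\,dt\Big]\\&+\frac1{4n}E\Big[\int_0^\infty|\nabla_tI_n(f_n)|\int_{2\lfloor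 t/2\rfloor}^{2\lfloor t/2\rfloor+2}|\nabla_sI_n(f_n)|^2\,ds\,dt\Big],\end{aligned}$$ where the terms on the right may be infinite. -/

import Mathlib

open MeasureTheory ProbabilityTheory Set Filter Topology
open scoped ENNReal NNReal

noncomputable section

namespace UniformSeq

/-- The canonical sample space: `ω k` is the value of the `k`-th variable `U_k`, `k = 0, 1, 2, …`. -/
abbrev Omega : Type := ℕ → ℝ

/-- The uniform probability law on `[-1, 1]`. -/
def unif : Measure ℝ := ProbabilityTheory.cond volume (Icc (-1 : ℝ) 1)

instance : IsProbabilityMeasure unif := by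
  unfold unif
  exact ProbabilityTheory.cond_isProbabilityMeasure_of_finite (by simp) (by simp)

/-- The law of an i.i.d. sequence of uniform random variables on `[-1, 1]`. -/
def prob : Measure Omega := Measure.infinitePi (fun _ : ℕ => unif)

/-- Lebesgue measure on `ℝ₊ = [0, ∞)`. -/
abbrev leb : Measure ℝ := volume.restrict (Ici (0 : ℝ))

/-- Lebesgue measure on `ℝ₊ⁿ`. -/
abbrev lebPi (n : ℕ) : Measure (Fin n → ℝ) := Measure.pi (fun _ : Fin n => leb)

/-- The set `Δ_n`: the union of the boxes `[2k₁, 2k₁+2] × ⋯ × [2kₙ, 2kₙ+2]` over pairwise distinct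
`k₁, …, kₙ ≥ 0`. -/
def Delta (n : ℕ) : Set (Fin n → ℝ) :=
  {x | ∃ k : Fin n ↪ ℕ, ∀ i, x i ∈ Icc (2 * (k i : ℝ)) (2 * (k i : ℝ) + 2)}

/-- (Representatives of) elements of the space of symmetric square-integrable functions on `ℝ₊ⁿ`
that vanish outside of `Δ_n`. -/
structure HatL2 (n : ℕ) (f : (Fin n → ℝ) → ℝ) : Prop where
  memLp : MemLp f 2 (lebPi n)
  symm : ∀ σ : Equiv.Perm (Fin n), (fun x => f (x ∘ σ)) =ᵐ[lebPi n] f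
  vanish : ∀ᵐ x ∂(lebPi n), x ∉ Delta n → f x = 0

/-- The point `(2k₁+1+U_{k₁}, …, 2k_r+1+U_{k_r}, y₁, …, y_{n-r})`. -/
def jumpPoint (n r : ℕ) (k : Fin r ↪ ℕ) (y : Fin (n - r) → ℝ) (ω : Omega) : Fin n → ℝ :=
  fun i =>
    if h : (i : ℕ) < r then 2 * (k ⟨i, h⟩ : ℝ) + 1 + ω (k ⟨i, h⟩)
    else y ⟨(i : ℕ) - r, by have := i.isLt; omega⟩

/-- The multiple stochastic integral of an integrable `f`, by its explicit formula
`∑_{r=0}^n (-1)^{n-r} / 2^{n-r} (n choose r) ∑_{k₁ ≠ ⋯ ≠ k_r}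
  ∫ ⋯ ∫ f (2k₁+1+U_{k₁}, …, 2k_r+1+U_{k_r}, y₁, …, y_{n-r}) dy`.
For integrable `f` the sum over the pairwise distinct `k₁, …, k_r` converges absolutely almost
surely. -/
def multIntL1 (n : ℕ) (f : (Fin n → ℝ) → ℝ) (ω : Omega) : ℝ :=
  ∑ r ∈ Finset.range (n + 1),
    (-1 : ℝ) ^ (n - r) / 2 ^ (n - r) * (n.choose r : ℝ) *
      ∑' k : Fin r ↪ ℕ, ∫ y, f (jumpPoint n r k y ω) ∂(lebPi (n - r))

/-- `X` is (a version of) the multiple stochastic integral `I_n(f)`, the `L²`-extension of the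
explicit formula: `X` is the limit in `L²(Ω)` of the integrals of some integrable functions `g m` of
the same space that converge to `f` in `L²(ℝ₊ⁿ)`. -/
def IsMultInt (n : ℕ) (f : (Fin n → ℝ) → ℝ) (X : Omega → ℝ) : Prop :=
  MemLp X 2 prob ∧
  ∃ g : ℕ → (Fin n → ℝ) → ℝ,
    (∀ m, HatL2 n (g m) ∧ Integrable (g m) (lebPi n)) ∧
    Tendsto (fun m => eLpNorm (fun x => g m x - f x) 2 (lebPi n)) atTop (𝓝 0) ∧
    Tendsto (fun m => eLpNorm (fun ω => multIntL1 n (g m) ω - X ω) 2 prob) atTop (𝓝 0)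

/-- The left end point `2⌊t/2⌋` of the block `[2⌊t/2⌋, 2⌊t/2⌋ + 2]` of `t ≥ 0`. -/
def blockStart (t : ℝ) : ℝ := 2 * (⌊t / 2⌋₊ : ℝ)

/-- The map `Ψ_t`, which replaces `U_{⌊t/2⌋}` by `t - 2⌊t/2⌋ - 1`. -/
def Psi (t : ℝ) (ω : Omega) : Omega :=
  Function.update ω ⌊t / 2⌋₊ (t - blockStart t - 1)

/-- The finite difference operator
`∇_t X = X ∘ Ψ_t - (1/2) ∫_{2⌊t/2⌋}^{2⌊t/2⌋+2} X ∘ Ψ_s ds`. -/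
def nabla (X : Omega → ℝ) (t : ℝ) (ω : Omega) : ℝ :=
  X (Psi t ω) - 1 / 2 * ∫ s in (blockStart t)..(blockStart t + 2), X (Psi s ω)

/-- The Wasserstein distance between two laws on `ℝ` (with finite first moments): the supremum
of `|∫ h dμ - ∫ h dν|` over the functions `h` with Lipschitz constant at most `1`. -/
def wassersteinDist (μ ν : Measure ℝ) : ℝ≥0∞ :=
  ⨆ (h : ℝ → ℝ) (_ : LipschitzWith 1 h), ENNReal.ofReal |(∫ x, h x ∂μ) - ∫ x, h x ∂ν|

end UniformSeq

end

/-! The proof is the Malliavin–Stein method. For a test function `h` with |h'| ≤ 1, Stein's equation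
g'(x) - x g(x) = h(x) - E[h(N)] has a solution with |g'| ≤ 1 and |g''| ≤ 2
(`exists_stein_solution`). With X = I_n(f), one must bound E[g'(X) - X g(X)]; general Lipschitz `h`
follow by smoothing.

The structure of X enters through one identity. Let E_j be averaging over the coordinate j. Then X
lies in the n-th Hoeffding chaos: it is an L² sum of terms attached to n distinct indices, each
annihilated by E_j for its own indices and fixed by E_j for all others. Hence Σ_j (X - E_j X) = nX,
in the weak form n E[X g(X)] = Σ_j E[(X - E_j X) g(X)] (`hasSum_inner_dev`).

Each summand is expanded to first order in its coordinate (`integral_mul_comp_sub_le`). The main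
term is E[g'(X) V_j], with V_j the conditional variance in the coordinate j; the error is at most
the expectation of E_j|a|³ + E_j|a| · E_j|a|², where a is the centred dependence on that coordinate.
The V_j add up to the squared norm of ∇X for dx/2, so |g'| ≤ 1 and the L¹–L² inequality give the
square root term, and the errors give the other two terms once averages over [-1,1] become integrals
over blocks of length 2.

To see that X is in the chaos, split the dy-integrals of the explicit formula into boxes. A box with
distinct indices gives 2^(n-r) times an average over the corresponding coordinates; a box with a
repeated index meets Δ_n in a null set. By symmetry the binomial coefficient counts the sets of
averaged positions, and the formula becomes the inclusion–exclusion sum ∏(1 - E_j) applied to f at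
the jump times (`ae_multIntL1_eq_sum`). Almost orthogonality of these terms makes the series a
continuous operator on L² (`multIntL`), which is therefore the required extension (`isMultInt_iff`).
-/

noncomputable section

namespace UniformSeq

/-! ### Stein's equation for the standard normal law -/

/-- The standard normal density. -/
def gaussDensity (x : ℝ) : ℝ := gaussianPDFReal 0 1 x

/-- The lower tail of the standard normal law. -/
def gaussLower (x : ℝ) : ℝ := ∫ t in Iic x, gaussDensity t

/-- The upper tail of the standard normal law. -/
def gaussUpper (x : ℝ) : ℝ := ∫ t in Ioi x, gaussDensity t

lemma gaussDensity_eq (x : ℝ) :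
    gaussDensity x = (√(2 * Real.pi))⁻¹ * Real.exp (-(1 / 2) * x ^ 2) := by
  simp only [gaussDensity, gaussianPDFReal]
  congr 2
  · simp
  · simp; ring

lemma gaussDensity_pos (x : ℝ) : 0 < gaussDensity x :=
  gaussianPDFReal_pos 0 1 x one_ne_zero

lemma gaussDensity_neg (x : ℝ) : gaussDensity (-x) = gaussDensity x := by
  simp [gaussDensity_eq]

lemma hasDerivAt_gaussDensity (x : ℝ) : HasDerivAt gaussDensity (-(x * gaussDensity x)) x := by
  have h1 : gaussDensity = fun x => (√(2 * Real.pi))⁻¹ * Real.exp (-(1 / 2) * x ^ 2) :=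
    funext gaussDensity_eq
  rw [h1]
  have h2 : HasDerivAt (fun y : ℝ => -(1 / 2) * y ^ 2) (-x) x := by
    have := (hasDerivAt_pow 2 x).const_mul (-(1 / 2) : ℝ)
    refine this.congr_deriv ?_
    simp
  refine (h2.exp.const_mul (√(2 * Real.pi))⁻¹).congr_deriv ?_
  ring

lemma continuous_gaussDensity : Continuous gaussDensity :=
  continuous_iff_continuousAt.2 fun x => (hasDerivAt_gaussDensity x).continuousAt

lemma integrable_gaussDensity : Integrable gaussDensity :=
  integrable_gaussianPDFReal 0 1

lemma integrable_id_mul_gaussDensity : Integrable fun t => t * gaussDensity t := by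
  have h := (integrable_mul_exp_neg_mul_sq (b := 1 / 2) (by norm_num)).const_mul
    (√(2 * Real.pi))⁻¹
  refine h.congr (ae_of_all _ fun t => ?_)
  simp only [gaussDensity_eq]
  ring

lemma gaussDensity_le (x : ℝ) : gaussDensity x ≤ 2 / 5 := by
  rw [gaussDensity_eq]
  have h1 : Real.exp (-(1 / 2) * x ^ 2) ≤ 1 := Real.exp_le_one_iff.2 (by nlinarith [sq_nonneg x])
  have h2 : (5 / 2 : ℝ) ≤ √(2 * Real.pi) :=
    Real.le_sqrt_of_sq_le (by nlinarith [Real.pi_gt_d2])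
  have h3 : (√(2 * Real.pi))⁻¹ ≤ 2 / 5 := by
    rw [inv_le_comm₀ (by linarith) (by norm_num)]
    linarith
  nlinarith [Real.exp_pos (-(1 / 2) * x ^ 2)]

lemma tendsto_gaussDensity_atTop : Tendsto gaussDensity atTop (𝓝 0) := by
  have h1 : Tendsto (fun x : ℝ => -(1 / 2) * x ^ 2) atTop atBot :=
    (tendsto_pow_atTop two_ne_zero).const_mul_atTop_of_neg (by norm_num)
  have h2 := (Real.tendsto_exp_atBot.comp h1).const_mul (√(2 * Real.pi))⁻¹
  rw [mul_zero] at h2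
  refine h2.congr fun x => ?_
  simp [gaussDensity_eq]

lemma tendsto_gaussDensity_atBot : Tendsto gaussDensity atBot (𝓝 0) := by
  have := tendsto_gaussDensity_atTop.comp tendsto_neg_atBot_atTop
  exact this.congr fun x => gaussDensity_neg x

lemma gaussLower_add_gaussUpper (x : ℝ) : gaussLower x + gaussUpper x = 1 := by
  have h := intervalIntegral.integral_Iic_add_Ioi (b := x) integrable_gaussDensity.integrableOn
    integrable_gaussDensity.integrableOn
  rw [gaussLower, gaussUpper, h]
  exact integral_gaussianPDFReal_eq_one 0 one_ne_zero

lemma gaussLower_eq_gaussUpper_neg (x : ℝ) : gaussLower x = gaussUpper (-x) := by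
  rw [gaussLower, gaussUpper, ← integral_comp_neg_Iic]
  simp [gaussDensity_neg]

lemma hasDerivAt_integral_Iic {F : ℝ → ℝ} (hF : Integrable F) (hc : Continuous F) (x : ℝ) :
    HasDerivAt (fun x => ∫ t in Iic x, F t) (F x) x := by
  have h1 : (fun x => ∫ t in Iic x, F t) = fun x => (∫ t in Iic 0, F t) + ∫ t in (0 : ℝ)..x, F t := by
    ext y
    rw [← intervalIntegral.integral_Iic_sub_Iic hF.integrableOn hF.integrableOn]
    ring
  rw [h1]
  exact (intervalIntegral.integral_hasDerivAt_right (hF.intervalIntegrable)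
    hc.aestronglyMeasurable.stronglyMeasurableAtFilter hc.continuousAt).const_add _

lemma hasDerivAt_integral_Ioi {F : ℝ → ℝ} (hF : Integrable F) (hc : Continuous F) (x : ℝ) :
    HasDerivAt (fun x => ∫ t in Ioi x, F t) (-F x) x := by
  have h1 : (fun x => ∫ t in Ioi x, F t) = fun x => (∫ t, F t) - ∫ t in Iic x, F t := by
    ext y
    rw [← intervalIntegral.integral_Iic_add_Ioi (b := y) hF.integrableOn hF.integrableOn]
    ring
  rw [h1]
  exact (hasDerivAt_integral_Iic hF hc x).const_sub _

lemma hasDerivAt_gaussLower (x : ℝ) : HasDerivAt gaussLower (gaussDensity x) x :=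
  hasDerivAt_integral_Iic integrable_gaussDensity continuous_gaussDensity x

lemma hasDerivAt_gaussUpper (x : ℝ) : HasDerivAt gaussUpper (-gaussDensity x) x :=
  hasDerivAt_integral_Ioi integrable_gaussDensity continuous_gaussDensity x

lemma gaussUpper_nonneg (x : ℝ) : 0 ≤ gaussUpper x :=
  integral_nonneg fun t => (gaussDensity_pos t).le

lemma integral_Iic_sub_mul_gaussDensity (x : ℝ) :
    ∫ t in Iic x, (x - t) * gaussDensity t = x * gaussLower x + gaussDensity x := by
  have h1 := integral_Iic_of_hasDerivAt_of_tendsto' (a := x) (f := gaussDensity)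
    (fun y _ => hasDerivAt_gaussDensity y) integrable_id_mul_gaussDensity.neg.integrableOn
    tendsto_gaussDensity_atBot
  rw [integral_neg] at h1
  simp_rw [sub_mul]
  rw [integral_sub (integrable_gaussDensity.const_mul x).integrableOn
    integrable_id_mul_gaussDensity.integrableOn, integral_const_mul, ← gaussLower]
  linarith

lemma integral_Ioi_sub_mul_gaussDensity (x : ℝ) :
    ∫ t in Ioi x, (t - x) * gaussDensity t = gaussDensity x - x * gaussUpper x := by
  have h1 := integral_Ioi_of_hasDerivAt_of_tendsto' (a := x) (f := gaussDensity)
    (fun y _ => hasDerivAt_gaussDensity y) integrable_id_mul_gaussDensity.neg.integrableOn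
    tendsto_gaussDensity_atTop
  rw [integral_neg] at h1
  simp_rw [sub_mul]
  rw [integral_sub integrable_id_mul_gaussDensity.integrableOn
    (integrable_gaussDensity.const_mul x).integrableOn, integral_const_mul, ← gaussUpper]
  linarith

lemma gaussUpper_mul_le (x : ℝ) : 0 ≤ gaussDensity x - x * gaussUpper x := by
  rw [← integral_Ioi_sub_mul_gaussDensity]
  exact setIntegral_nonneg measurableSet_Ioi fun t ht =>
    mul_nonneg (sub_nonneg.2 (le_of_lt ht)) (gaussDensity_pos t).le

/-- Birnbaum's lower bound for the Mills ratio. -/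
def millsLower (x : ℝ) : ℝ := (√(x ^ 2 + 4) - x) / 2

lemma millsLower_pos (x : ℝ) : 0 < millsLower x := by
  have : x < √(x ^ 2 + 4) := Real.lt_sqrt_of_sq_lt (by linarith)
  unfold millsLower
  linarith

lemma millsLower_sq (x : ℝ) : millsLower x ^ 2 + x * millsLower x = 1 := by
  have := Real.sq_sqrt (show 0 ≤ x ^ 2 + 4 by positivity)
  unfold millsLower
  nlinarith

lemma hasDerivAt_millsLower (x : ℝ) :
    HasDerivAt millsLower (-(millsLower x / √(x ^ 2 + 4))) x := by
  have h0 : (x ^ 2 + 4) ≠ 0 := by positivity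
  have h1 : HasDerivAt (fun y : ℝ => y ^ 2 + 4) (2 * x) x := by
    simpa using (hasDerivAt_pow 2 x).add_const 4
  have h2 := ((h1.sqrt h0).sub (hasDerivAt_id x)).div_const 2
  refine h2.congr_deriv ?_
  have h3 : √(x ^ 2 + 4) ≠ 0 := by positivity
  unfold millsLower
  field_simp
  ring

/-- The difference of the two sides tends to 0 at +∞, so it is enough that it decreases. Write p for
the density, θ for `millsLower` and s = √(x² + 4). Since θ² + xθ = 1, the derivative is p(θ/s - θ²),
which is nonpositive because θs ≥ 1. -/
lemma millsLower_mul_le_gaussUpper (x : ℝ) : millsLower x * gaussDensity x ≤ gaussUpper x := by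
  let D : ℝ → ℝ := fun y => gaussUpper y - millsLower y * gaussDensity y
  have hD : ∀ y, HasDerivAt D (-gaussDensity y -
      (-(millsLower y / √(y ^ 2 + 4)) * gaussDensity y
        + millsLower y * -(y * gaussDensity y))) y := fun y =>
    (hasDerivAt_gaussUpper y).sub ((hasDerivAt_millsLower y).mul (hasDerivAt_gaussDensity y))
  have hanti : Antitone D := by
    refine antitone_of_deriv_nonpos (fun y => (hD y).differentiableAt) fun y => ?_
    rw [(hD y).deriv]
    have h1 := millsLower_sq y
    have h2 := millsLower_pos y
    have h3 := gaussDensity_pos y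
    have hs : 0 < √(y ^ 2 + 4) := by positivity
    have hs2 := Real.sq_sqrt (show 0 ≤ y ^ 2 + 4 by positivity)
    have h4 : 1 ≤ millsLower y * √(y ^ 2 + 4) := by
      have : y * √(y ^ 2 + 4) ≤ y ^ 2 + 2 := by
        apply le_of_sq_le_sq _ (by positivity)
        nlinarith
      unfold millsLower
      nlinarith
    have h5 : millsLower y / √(y ^ 2 + 4) ≤ millsLower y ^ 2 := by
      rw [div_le_iff₀ hs]
      nlinarith
    nlinarith
  have hlim : Tendsto D atTop (𝓝 0) := by
    have e1 : Tendsto gaussUpper atTop (𝓝 0) := by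
      refine squeeze_zero' (Eventually.of_forall gaussUpper_nonneg) ?_ tendsto_gaussDensity_atTop
      filter_upwards [eventually_ge_atTop 1] with y hy
      nlinarith [gaussUpper_mul_le y, gaussUpper_nonneg y]
    have e2 : Tendsto (fun y => millsLower y * gaussDensity y) atTop (𝓝 0) := by
      refine squeeze_zero' (Eventually.of_forall fun y =>
        (mul_pos (millsLower_pos y) (gaussDensity_pos y)).le) ?_ tendsto_gaussDensity_atTop
      filter_upwards [eventually_ge_atTop 0] with y hy
      have : millsLower y ≤ 1 := by
        nlinarith [millsLower_sq y, mul_nonneg hy (millsLower_pos y).le, millsLower_pos y]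
      nlinarith [gaussDensity_pos y]
    simpa using e1.sub e2
  have := hanti.le_of_tendsto hlim x
  simp only [D] at this
  linarith

/-- The identity (1 + x²)θ - x = θ³ for θ = `millsLower x` reduces this to Birnbaum's bound. It
makes the weights nonnegative in the estimate of the second derivative of the Stein solution. -/
lemma mul_gaussDensity_le_gaussUpper (x : ℝ) :
    x * gaussDensity x ≤ (1 + x ^ 2) * gaussUpper x := by
  have h1 := millsLower_mul_le_gaussUpper x
  have h2 := millsLower_sq x
  have h3 := millsLower_pos x
  have h4 : x ≤ (1 + x ^ 2) * millsLower x := by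
    have : (1 + x ^ 2) * millsLower x - x = millsLower x ^ 3 := by
      linear_combination (-millsLower x - (- x)) * h2
    nlinarith [pow_pos h3 3]
  calc x * gaussDensity x ≤ (1 + x ^ 2) * millsLower x * gaussDensity x :=
        mul_le_mul_of_nonneg_right h4 (gaussDensity_pos x).le
    _ ≤ _ := by rw [mul_assoc]; exact mul_le_mul_of_nonneg_left h1 (by positivity)

/-- For x ≥ 0, Birnbaum's bound gives b ≤ p(1 - xθ) = pθ² for the upper tail moment b. With p ≤ 2/5
and xθ = 1 - θ², only a polynomial inequality in θ ∈ [0,1] remains. -/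
lemma two_mul_tails_le_of_nonneg {x : ℝ} (hx : 0 ≤ x) :
    2 * ((x + (gaussDensity x - x * gaussUpper x)) * (gaussDensity x - x * gaussUpper x))
      ≤ gaussDensity x := by
  have h1 := millsLower_mul_le_gaussUpper x
  have h2 := millsLower_sq x
  have h3 := millsLower_pos x
  have hb := gaussUpper_mul_le x
  have hp := gaussDensity_pos x
  have hp2 := gaussDensity_le x
  set b := gaussDensity x - x * gaussUpper x
  set p := gaussDensity x
  set θ := millsLower x
  have hbθ : b ≤ p * θ ^ 2 := by
    have : x * (θ * p) ≤ x * gaussUpper x := mul_le_mul_of_nonneg_left h1 hx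
    nlinarith
  have hθ1 : θ ≤ 1 := by nlinarith [mul_nonneg hx h3.le]
  have hb2 : b ≤ 2 / 5 * θ ^ 2 := hbθ.trans (by nlinarith [sq_nonneg θ])
  have h5 : (x + b) * b ≤ (x + 2 / 5 * θ ^ 2) * (p * θ ^ 2) :=
    mul_le_mul (by linarith) hbθ hb (by positivity)
  have h6 : (x + 2 / 5 * θ ^ 2) * (p * θ ^ 2) = p * (θ * (1 - θ ^ 2) + 2 / 5 * θ ^ 4) := by
    linear_combination p * θ * h2
  have h7 : θ * (1 - θ ^ 2) + 2 / 5 * θ ^ 4 ≤ 1 / 2 := by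
    nlinarith [sq_nonneg (θ - 3/4), sq_nonneg (θ ^ 2 - 9/16), mul_nonneg h3.le (sub_nonneg.2 hθ1),
      mul_nonneg h3.le (sq_nonneg (θ - 3/4))]
  nlinarith

/-- The reflection x ↦ -x exchanges the two factors, so the case x ≥ 0 suffices. This inequality is
what gives |g'| ≤ 1 for the Stein solution. -/
lemma two_mul_tails_le (x : ℝ) :
    2 * ((x * gaussLower x + gaussDensity x) * (gaussDensity x - x * gaussUpper x))
      ≤ gaussDensity x := by
  have hs := gaussLower_add_gaussUpper x
  rcases le_total 0 x with hx | hx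
  · have := two_mul_tails_le_of_nonneg hx
    have e : x + (gaussDensity x - x * gaussUpper x) = x * gaussLower x + gaussDensity x := by
      linear_combination -x * hs
    rwa [e] at this
  · have := two_mul_tails_le_of_nonneg (x := -x) (by linarith)
    rw [gaussDensity_neg, ← gaussLower_eq_gaussUpper_neg] at this
    have e : -x + (gaussDensity x - -x * gaussLower x) = gaussDensity x - x * gaussUpper x := by
      linear_combination x * hs
    rw [e] at this
    linarith

/-- Taylor's inequality of order two for a function with derivative bounds. -/
lemma abs_taylor_two_le {g g1 g2 : ℝ → ℝ} {C : ℝ} (h1 : ∀ x, HasDerivAt g (g1 x) x)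
    (h2 : ∀ x, HasDerivAt g1 (g2 x) x) (hC : ∀ x, |g2 x| ≤ 2 * C) (x y : ℝ) :
    |g y - g x - g1 x * (y - x)| ≤ C * (y - x) ^ 2 := by
  have key : ∀ (g g1 g2 : ℝ → ℝ), (∀ x, HasDerivAt g (g1 x) x) → (∀ x, HasDerivAt g1 (g2 x) x) →
      (∀ x, g2 x ≤ 2 * C) → ∀ x y, g y - g x - g1 x * (y - x) ≤ C * (y - x) ^ 2 := by
    intro g g1 g2 h1 h2 hC x y
    let F : ℝ → ℝ := fun z => g z - g x - g1 x * (z - x) - C * (z - x) ^ 2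
    let F1 : ℝ → ℝ := fun z => g1 z - g1 x - 2 * C * (z - x)
    have hF : ∀ z, HasDerivAt F (F1 z) z := fun z => by
      have a1 := (hasDerivAt_id z).sub_const x
      have := (((h1 z).sub_const (g x)).sub (a1.const_mul (g1 x))).sub ((a1.pow 2).const_mul C)
      refine this.congr_deriv ?_
      simp [F1]
      ring
    have hF1 : Antitone F1 := by
      have hd : ∀ z, HasDerivAt F1 (g2 z - 2 * C * 1) z := fun z =>
        ((h2 z).sub_const _).sub (((hasDerivAt_id z).sub_const x).const_mul (2 * C))
      refine antitone_of_deriv_nonpos (fun z => (hd z).differentiableAt) fun z => ?_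
      rw [(hd z).deriv]
      linarith [hC z]
    have hF1x : F1 x = 0 := by simp [F1]
    have hFx : F x = 0 := by simp [F]
    suffices F y ≤ 0 by
      simp only [F] at this
      linarith
    rw [← hFx]
    have hcont : Continuous F := continuous_iff_continuousAt.2 fun z => (hF z).continuousAt
    -- The derivative of `F` is antitone and vanishes at `x`, so `F` increases up to `x` and
    -- decreases afterwards.
    rcases le_total x y with hxy | hxy
    · refine antitoneOn_of_deriv_nonpos (convex_Ici x) hcont.continuousOn
        (fun z _ => (hF z).differentiableAt.differentiableWithinAt) (fun z hz => ?_)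
        (mem_Ici.2 le_rfl) (mem_Ici.2 hxy) hxy
      rw [(hF z).deriv, ← hF1x]
      rw [interior_Ici] at hz
      exact hF1 (le_of_lt hz)
    · refine monotoneOn_of_deriv_nonneg (convex_Iic x) hcont.continuousOn
        (fun z _ => (hF z).differentiableAt.differentiableWithinAt) (fun z hz => ?_)
        (mem_Iic.2 hxy) (mem_Iic.2 le_rfl) hxy
      rw [(hF z).deriv, ← hF1x]
      rw [interior_Iic] at hz
      exact hF1 (le_of_lt hz)
  rw [abs_le]
  refine ⟨?_, key g g1 g2 h1 h2 (fun x => (le_abs_self _).trans (hC x)) x y⟩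
  have := key (fun z => -g z) (fun z => -g1 z) (fun z => -g2 z) (fun z => (h1 z).neg)
    (fun z => (h2 z).neg) (fun z => (neg_le_abs _).trans (hC z)) x y
  linarith

lemma abs_sub_le_of_hasDerivAt {h h1 : ℝ → ℝ} (hd : ∀ x, HasDerivAt h (h1 x) x)
    (hb : ∀ x, |h1 x| ≤ 1) (x y : ℝ) : |h x - h y| ≤ |x - y| := by
  have := Convex.norm_image_sub_le_of_norm_hasDerivWithin_le (s := univ) (C := 1) (x := y) (y := x)
    (fun z _ => (hd z).hasDerivWithinAt) (fun z _ => by simpa using hb z) convex_univ trivial trivial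
  simpa using this

/-- A solution of Stein's equation for a test function with derivative bounded by `1`. -/
theorem exists_stein_solution {h h1 : ℝ → ℝ} (hd : ∀ x, HasDerivAt h (h1 x) x)
    (hb : ∀ x, |h1 x| ≤ 1) :
    ∃ g g1 : ℝ → ℝ, (∀ x, HasDerivAt g (g1 x) x) ∧ Continuous g1 ∧ (∀ x, |g1 x| ≤ 1) ∧
      (∀ x, g1 x - x * g x = h x - ∫ y, h y ∂(gaussianReal 0 1)) ∧
      ∀ x y, |g y - g x - g1 x * (y - x)| ≤ (y - x) ^ 2 := by
  have hlip := abs_sub_le_of_hasDerivAt hd hb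
  have hcont : Continuous h := continuous_iff_continuousAt.2 fun z => (hd z).continuousAt
  have hint : Integrable fun t => h t * gaussDensity t := by
    refine Integrable.mono' (g := fun t => |h 0| * gaussDensity t + |t * gaussDensity t|)
      ((integrable_gaussDensity.const_mul _).add integrable_id_mul_gaussDensity.abs)
      (hcont.mul continuous_gaussDensity).aestronglyMeasurable (ae_of_all _ fun t => ?_)
    have := hlip t 0
    rw [Real.norm_eq_abs, abs_mul, abs_mul, abs_of_pos (gaussDensity_pos t), ← add_mul]
    refine mul_le_mul_of_nonneg_right ?_ (gaussDensity_pos t).le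
    rw [sub_zero] at this
    linarith [abs_sub_abs_le_abs_sub (h t) (h 0)]
  -- These are the integrals of (h x - h t)p(t) over the lower tail and of (h t - h x)p(t) over the
  -- upper tail. The Lipschitz bound dominates them by the first moments of the tails.
  let A : ℝ → ℝ := fun x => h x * gaussLower x - ∫ t in Iic x, h t * gaussDensity t
  let B : ℝ → ℝ := fun x => (∫ t in Ioi x, h t * gaussDensity t) - h x * gaussUpper x
  have hA : ∀ x, |A x| ≤ x * gaussLower x + gaussDensity x := fun x => by
    have e : A x = ∫ t in Iic x, (h x - h t) * gaussDensity t := by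
      simp_rw [sub_mul]
      rw [integral_sub (integrable_gaussDensity.const_mul _).integrableOn hint.integrableOn,
        integral_const_mul]
      rfl
    rw [e, ← integral_Iic_sub_mul_gaussDensity]
    refine norm_integral_le_of_norm_le (f := fun t => (h x - h t) * gaussDensity t) ?_ ?_
    · have := (integrable_gaussDensity.const_mul x).sub integrable_id_mul_gaussDensity
      simp_rw [sub_mul]
      exact this.integrableOn
    · filter_upwards [ae_restrict_mem measurableSet_Iic] with t ht
      rw [norm_mul, Real.norm_eq_abs, Real.norm_eq_abs, abs_of_pos (gaussDensity_pos t)]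
      refine mul_le_mul_of_nonneg_right ((hlip x t).trans ?_) (gaussDensity_pos t).le
      rw [abs_of_nonneg (sub_nonneg.2 ht)]
  have hB : ∀ x, |B x| ≤ gaussDensity x - x * gaussUpper x := fun x => by
    have e : B x = ∫ t in Ioi x, (h t - h x) * gaussDensity t := by
      simp_rw [sub_mul]
      rw [integral_sub hint.integrableOn (integrable_gaussDensity.const_mul _).integrableOn,
        integral_const_mul]
      rfl
    rw [e, ← integral_Ioi_sub_mul_gaussDensity]
    refine norm_integral_le_of_norm_le (f := fun t => (h t - h x) * gaussDensity t) ?_ ?_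
    · have := integrable_id_mul_gaussDensity.sub (integrable_gaussDensity.const_mul x)
      simp_rw [sub_mul]
      exact this.integrableOn
    · filter_upwards [ae_restrict_mem measurableSet_Ioi] with t ht
      rw [norm_mul, Real.norm_eq_abs, Real.norm_eq_abs, abs_of_pos (gaussDensity_pos t)]
      refine mul_le_mul_of_nonneg_right ((hlip t x).trans ?_) (gaussDensity_pos t).le
      rw [abs_of_nonneg (sub_nonneg.2 (le_of_lt ht))]
  have hAd : ∀ x, HasDerivAt A (h1 x * gaussLower x) x := fun x => by
    have := ((hd x).mul (hasDerivAt_gaussLower x)).sub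
      (hasDerivAt_integral_Iic hint (hcont.mul continuous_gaussDensity) x)
    refine this.congr_deriv ?_
    simp
  have hBd : ∀ x, HasDerivAt B (-(h1 x * gaussUpper x)) x := fun x => by
    have := (hasDerivAt_integral_Ioi hint (hcont.mul continuous_gaussDensity) x).sub
      ((hd x).mul (hasDerivAt_gaussUpper x))
    refine this.congr_deriv ?_
    ring
  have hAB : ∀ x, A x - B x = h x - ∫ y, h y ∂(gaussianReal 0 1) := fun x => by
    rw [integral_gaussianReal_eq_integral_smul one_ne_zero]
    have e : ∫ y, gaussianPDFReal 0 1 y • h y = ∫ y, h y * gaussDensity y :=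
      integral_congr_ae (ae_of_all _ fun y => by simp [gaussDensity, mul_comm])
    rw [e, ← intervalIntegral.integral_Iic_add_Ioi (b := x) hint.integrableOn hint.integrableOn]
    simp only [A, B]
    linear_combination h x * gaussLower_add_gaussUpper x
  -- This is the classical solution p(x)⁻¹ ∫_{-∞}^x (h - E[h(N)]) p, rewritten through `A` and `B`
  -- so that the tail bounds apply.
  let g : ℝ → ℝ := fun x => -(gaussUpper x * A x + gaussLower x * B x) / gaussDensity x
  let g1 : ℝ → ℝ := fun x => x * g x + (A x - B x)
  have hg : ∀ x, HasDerivAt g (g1 x) x := fun x => by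
    have hne := (gaussDensity_pos x).ne'
    have := (((hasDerivAt_gaussUpper x).mul (hAd x)).add
      ((hasDerivAt_gaussLower x).mul (hBd x))).neg.div (hasDerivAt_gaussDensity x) hne
    refine this.congr_deriv ?_
    simp only [g1, g, Pi.mul_apply, Pi.add_apply, Pi.neg_apply]
    field_simp
    ring
  let g2 : ℝ → ℝ := fun x => g x + x * g1 x + h1 x
  have hg1 : ∀ x, HasDerivAt g1 (g2 x) x := fun x => by
    have e : g1 = fun x => x * g x + (h x - ∫ y, h y ∂(gaussianReal 0 1)) := by
      ext y; simp only [g1, hAB]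
    rw [e]
    have := ((hasDerivAt_id x).mul (hg x)).add ((hd x).sub_const (∫ y, h y ∂(gaussianReal 0 1)))
    refine this.congr_deriv ?_
    simp [g2]
  have hg1b : ∀ x, |g1 x| ≤ 1 := fun x => by
    have hp := gaussDensity_pos x
    have hs := gaussLower_add_gaussUpper x
    have e : gaussDensity x * g1 x = (gaussDensity x - x * gaussUpper x) * A x
        - (x * gaussLower x + gaussDensity x) * B x := by
      simp only [g1, g]
      field_simp
      ring
    have ha : 0 ≤ x * gaussLower x + gaussDensity x := (abs_nonneg _).trans (hA x)
    have hb := gaussUpper_mul_le x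
    have : gaussDensity x * |g1 x| ≤ gaussDensity x := by
      rw [← abs_of_pos hp, ← abs_mul, e, abs_of_pos hp]
      refine (abs_sub _ _).trans ?_
      rw [abs_mul, abs_mul, abs_of_nonneg hb, abs_of_nonneg ha]
      have := two_mul_tails_le x
      nlinarith [mul_le_mul_of_nonneg_left (hA x) hb, mul_le_mul_of_nonneg_left (hB x) ha]
    exact le_of_mul_le_mul_left (by simpa using this) hp
  have hg2b : ∀ x, |g2 x| ≤ 2 * 1 := fun x => by
    have hp := gaussDensity_pos x
    have hs := gaussLower_add_gaussUpper x
    have e : gaussDensity x * (g2 x - h1 x) =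
        -(((1 + x ^ 2) * gaussUpper x - x * gaussDensity x) * A x)
        - ((1 + x ^ 2) * gaussLower x + x * gaussDensity x) * B x := by
      simp only [g2, g1, g]
      field_simp
      ring
    have hc : 0 ≤ (1 + x ^ 2) * gaussUpper x - x * gaussDensity x :=
      sub_nonneg.2 (mul_gaussDensity_le_gaussUpper x)
    have hd : 0 ≤ (1 + x ^ 2) * gaussLower x + x * gaussDensity x := by
      have := mul_gaussDensity_le_gaussUpper (-x)
      rw [gaussDensity_neg, ← gaussLower_eq_gaussUpper_neg] at this
      nlinarith
    have : gaussDensity x * |g2 x - h1 x| ≤ gaussDensity x := by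
      rw [← abs_of_pos hp, ← abs_mul, e, abs_of_pos hp]
      refine (abs_sub _ _).trans ?_
      rw [abs_neg, abs_mul, abs_mul, abs_of_nonneg hc, abs_of_nonneg hd]
      -- The nonnegative weights of `A` and `B`, multiplied by the bounds for `A` and `B`, add up
      -- exactly to the density. Hence |g'' - h'| ≤ 1 and |g''| ≤ 2, which gives constant 1 in
      -- Taylor's inequality.
      have e2 : ((1 + x ^ 2) * gaussUpper x - x * gaussDensity x)
            * (x * gaussLower x + gaussDensity x)
          + ((1 + x ^ 2) * gaussLower x + x * gaussDensity x)
            * (gaussDensity x - x * gaussUpper x) = gaussDensity x := by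
        linear_combination gaussDensity x * hs
      linarith [mul_le_mul_of_nonneg_left (hA x) hc, mul_le_mul_of_nonneg_left (hB x) hd]
    have h3 : |g2 x - h1 x| ≤ 1 := le_of_mul_le_mul_left (by simpa using this) hp
    calc |g2 x| = |(g2 x - h1 x) + h1 x| := by ring_nf
      _ ≤ |g2 x - h1 x| + |h1 x| := abs_add_le _ _
      _ ≤ 2 * 1 := by linarith [hb x]
  refine ⟨g, g1, hg, continuous_iff_continuousAt.2 fun x => (hg1 x).continuousAt, hg1b,
    fun x => ?_, fun x y => ?_⟩
  · rw [← hAB]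
    simp only [g1]
    ring
  · simpa using abs_taylor_two_le hg hg1 hg2b x y

/-- A Lipschitz function is uniformly approximated by differentiable ones with the same bound. -/
lemma exists_smooth_approx {h : ℝ → ℝ} (hh : LipschitzWith 1 h) {ε : ℝ} (hε : 0 < ε) :
    ∃ k k1 : ℝ → ℝ, (∀ x, HasDerivAt k (k1 x) x) ∧ (∀ x, |k1 x| ≤ 1) ∧ ∀ x, |h x - k x| ≤ ε := by
  have hlip : ∀ x y, |h x - h y| ≤ |x - y| := fun x y => by
    simpa [Real.dist_eq] using hh.dist_le_mul x y
  have hI : ∀ a b, IntervalIntegrable h volume a b := fun a b => hh.continuous.intervalIntegrable a b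
  have hF : ∀ x, HasDerivAt (fun x => ∫ t in (0 : ℝ)..x, h t) (h x) x := fun x =>
    intervalIntegral.integral_hasDerivAt_right (hI _ _)
      hh.continuous.aestronglyMeasurable.stronglyMeasurableAtFilter hh.continuous.continuousAt
  -- The approximant is the mean of `h` over [x, x + ε]. Its derivative is a difference quotient of
  -- `h`.
  refine ⟨fun x => ε⁻¹ * ((∫ t in (0 : ℝ)..(x + ε), h t) - ∫ t in (0 : ℝ)..x, h t),
    fun x => ε⁻¹ * (h (x + ε) - h x), fun x => ?_, fun x => ?_, fun x => ?_⟩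
  · exact (((hF (x + ε)).comp_add_const x ε).sub (hF x)).const_mul _
  · rw [abs_mul, abs_of_pos (inv_pos.2 hε), inv_mul_le_iff₀ hε]
    have := hlip (x + ε) x
    rw [add_sub_cancel_left, abs_of_pos hε] at this
    linarith
  · simp only []
    rw [intervalIntegral.integral_interval_sub_left (hI _ _) (hI _ _)]
    have e : h x - ε⁻¹ * ∫ t in x..(x + ε), h t = ε⁻¹ * ∫ t in x..(x + ε), (h x - h t) := by
      rw [intervalIntegral.integral_sub (by simp) (hI _ _)]
      simp
      field_simp
    rw [e, abs_mul, abs_of_pos (inv_pos.2 hε), inv_mul_le_iff₀ hε]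
    have := intervalIntegral.norm_integral_le_of_norm_le_const (a := x) (b := x + ε) (C := ε)
      (f := fun t => h x - h t) (fun t ht => by
        rw [uIoc_of_le (by linarith)] at ht
        refine (hlip x t).trans ?_
        rw [abs_sub_comm, abs_of_nonneg (by linarith [ht.1])]
        linarith [ht.2])
    simpa [abs_of_pos hε] using this

/-! ### Families of orthogonal projections and their eigenspaces -/

section Hilbert

open scoped InnerProductSpace

variable {H ι κ : Type*} [NormedAddCommGroup H] [InnerProductSpace ℝ H]

/-- A family of orthogonal projections, thought of as averaging operators. -/
structure IsProjFamily (E : ι → H →ₗ[ℝ] H) : Prop where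
  symm : ∀ j x y, ⟪E j x, y⟫_ℝ = ⟪x, E j y⟫_ℝ
  idem : ∀ j x, E j (E j x) = E j x

/-- The complementary projections. -/
def dev (E : ι → H →ₗ[ℝ] H) (j : ι) : H →ₗ[ℝ] H := LinearMap.id - E j

lemma dev_apply (E : ι → H →ₗ[ℝ] H) (j : ι) (x : H) : dev E j x = x - E j x := rfl

namespace IsProjFamily

variable {E : ι → H →ₗ[ℝ] H} (hE : IsProjFamily E)
include hE

lemma inner_dev_symm (j : ι) (x y : H) : ⟪dev E j x, y⟫_ℝ = ⟪x, dev E j y⟫_ℝ := by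
  simp only [dev_apply, inner_sub_left, inner_sub_right, hE.symm]

lemma dev_idem (j : ι) (x : H) : dev E j (dev E j x) = dev E j x := by
  simp only [dev_apply, map_sub, hE.idem, sub_self, sub_zero]

lemma inner_dev_dev (j : ι) (x y : H) : ⟪dev E j x, dev E j y⟫_ℝ = ⟪dev E j x, y⟫_ℝ := by
  rw [← hE.inner_dev_symm, hE.dev_idem]

lemma norm_dev_sq (j : ι) (x : H) : ‖dev E j x‖ ^ 2 = ⟪dev E j x, x⟫_ℝ := by
  rw [← real_inner_self_eq_norm_sq, hE.inner_dev_dev]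

lemma norm_dev_le (j : ι) (x : H) : ‖dev E j x‖ ≤ ‖x‖ := by
  have h := hE.norm_dev_sq j x
  have h2 := real_inner_le_norm (dev E j x) x
  rcases (norm_nonneg (dev E j x)).eq_or_lt with h0 | h0
  · rw [← h0]; exact norm_nonneg x
  · nlinarith

lemma norm_apply_le (j : ι) (x : H) : ‖E j x‖ ≤ ‖x‖ := by
  have h : ‖E j x‖ ^ 2 = ⟪E j x, x⟫_ℝ := by
    rw [← real_inner_self_eq_norm_sq, ← hE.symm, hE.idem]
  have h2 := real_inner_le_norm (E j x) x
  rcases (norm_nonneg (E j x)).eq_or_lt with h0 | h0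
  · rw [← h0]; exact norm_nonneg x
  · nlinarith

lemma continuous_dev (j : ι) : Continuous (dev E j) :=
  ((dev E j).mkContinuous 1 fun x => by simpa using hE.norm_dev_le j x).continuous

/-- Among the vectors fixed by `E j`, the vector `E j y` is the closest one to `y`. -/
lemma norm_dev_le_of_fixed (j : ι) (y : H) {w : H} (hw : E j w = w) :
    ‖dev E j y‖ ≤ ‖y - w‖ := by
  have : dev E j y = dev E j (y - w) := by simp [dev_apply, hw]
  rw [this]
  exact hE.norm_dev_le j _

end IsProjFamily

/-- The vectors that only finitely many complementary projections do not annihilate, and on which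
the sum of these projections acts as multiplication by `n`. -/
def finChaos (E : ι → H →ₗ[ℝ] H) (n : ℕ) : Submodule ℝ H where
  -- Asking for the property at every larger set makes the witness monotone, so that a sum of two
  -- vectors can use the union of their witnesses.
  carrier := {z | ∃ J : Finset ι, ∀ J', J ⊆ J' →
    (∀ j ∉ J', dev E j z = 0) ∧ ∑ j ∈ J', dev E j z = (n : ℝ) • z}
  zero_mem' := ⟨∅, by simp⟩
  add_mem' := by
    classical
    rintro a b ⟨J, hJ⟩ ⟨K, hK⟩
    refine ⟨J ∪ K, fun J' h => ?_⟩
    obtain ⟨h1, h2⟩ := hJ J' (Finset.subset_union_left.trans h)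
    obtain ⟨h3, h4⟩ := hK J' (Finset.subset_union_right.trans h)
    refine ⟨fun j hj => by rw [map_add, h1 j hj, h3 j hj, add_zero], ?_⟩
    simp only [map_add, Finset.sum_add_distrib, h2, h4, smul_add]
  smul_mem' := by
    rintro c a ⟨J, hJ⟩
    refine ⟨J, fun J' h => ?_⟩
    obtain ⟨h1, h2⟩ := hJ J' h
    refine ⟨fun j hj => by rw [map_smul, h1 j hj, smul_zero], ?_⟩
    simp only [map_smul, ← Finset.smul_sum, h2, smul_comm c]

/-- The complementary projection of index j fixes `G k` for j in `s k` and kills it otherwise, so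
their sum counts the n elements of `s k`. -/
lemma sum_mem_finChaos {E : ι → H →ₗ[ℝ] H} {n : ℕ} {G : κ → H} {s : κ → Finset ι}
    (hcard : ∀ k, (s k).card = n) (h0 : ∀ k, ∀ j ∈ s k, E j (G k) = 0)
    (h1 : ∀ k, ∀ j ∉ s k, E j (G k) = G k) (t : Finset κ) : ∑ k ∈ t, G k ∈ finChaos E n := by
  classical
  refine Submodule.sum_mem _ fun k _ => ⟨s k, fun J' hJ' => ?_⟩
  have hd : ∀ j, dev E j (G k) = if j ∈ s k then G k else 0 := fun j => by
    split_ifs with hj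
    · rw [dev_apply, h0 k j hj, sub_zero]
    · rw [dev_apply, h1 k j hj, sub_self]
  refine ⟨fun j hj => by rw [hd, if_neg fun h => hj (hJ' h)], ?_⟩
  simp only [hd, Finset.sum_ite_mem, Finset.inter_eq_right.2 hJ', Finset.sum_const, hcard]
  rw [Nat.cast_smul_eq_nsmul]

namespace IsProjFamily

variable {E : ι → H →ₗ[ℝ] H} (hE : IsProjFamily E)
include hE

/-- On `finChaos` the full sum is the inner product of Σ_j dev_j x = nx with x, an equality. Only
the inequality for finite sums is a closed condition, and it passes to the closure. -/
lemma sum_norm_dev_sq_le {n : ℕ} {x : H} (hx : x ∈ (finChaos E n).topologicalClosure)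
    (J : Finset ι) : ∑ j ∈ J, ‖dev E j x‖ ^ 2 ≤ n * ‖x‖ ^ 2 := by
  classical
  have hcl : IsClosed {x : H | ∑ j ∈ J, ‖dev E j x‖ ^ 2 ≤ n * ‖x‖ ^ 2} :=
    isClosed_le (continuous_finsetSum _ fun j _ => (hE.continuous_dev j).norm.pow 2) (by fun_prop)
  refine closure_minimal (s := (finChaos E n : Set H)) ?_ hcl hx
  rintro z ⟨K, hK⟩
  have h := (hK (J ∪ K) Finset.subset_union_right).2
  calc ∑ j ∈ J, ‖dev E j z‖ ^ 2 ≤ ∑ j ∈ J ∪ K, ‖dev E j z‖ ^ 2 :=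
        Finset.sum_le_sum_of_subset_of_nonneg Finset.subset_union_left fun _ _ _ => by positivity
    _ = ∑ j ∈ J ∪ K, ⟪dev E j z, z⟫_ℝ := by simp only [hE.norm_dev_sq]
    _ = n * ‖z‖ ^ 2 := by
      rw [← sum_inner, h, inner_smul_left, real_inner_self_eq_norm_sq]; simp

lemma summable_norm_dev_sq {n : ℕ} {x : H} (hx : x ∈ (finChaos E n).topologicalClosure) :
    Summable fun j => ‖dev E j x‖ ^ 2 :=
  summable_of_sum_le (fun _ => by positivity) (hE.sum_norm_dev_sq_le hx)

/-- The eigenvalue equation Σ_j dev_j x = nx, tested against `y`. It holds exactly for an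
approximant `z` in `finChaos` as soon as the finite set contains the witness of `z`. The error from
x - z is at most C‖x - z‖ uniformly in the finite set, by Cauchy–Schwarz, since one may also put
dev_j on `y`. -/
lemma hasSum_inner_dev {n : ℕ} {x y : H} (hx : x ∈ (finChaos E n).topologicalClosure)
    (hy : Summable fun j => ‖dev E j y‖ ^ 2) :
    HasSum (fun j => ⟪dev E j x, y⟫_ℝ) (n * ⟪x, y⟫_ℝ) := by
  classical
  set C := √n * √(∑' j, ‖dev E j y‖ ^ 2) + n * ‖y‖ with hC
  have hC0 : 0 ≤ C := by positivity
  rw [HasSum, SummationFilter.unconditional_filter, Metric.tendsto_atTop]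
  intro ε hε
  obtain ⟨z, hz, hxz⟩ := Metric.mem_closure_iff.1 hx (ε / (C + 1)) (by positivity)
  have hxz' : ‖x - z‖ * C < ε := by
    rw [dist_eq_norm, lt_div_iff₀ (by positivity)] at hxz
    nlinarith [norm_nonneg (x - z)]
  have hw : x - z ∈ (finChaos E n).topologicalClosure :=
    Submodule.sub_mem _ hx ((finChaos E n).le_topologicalClosure hz)
  obtain ⟨J, hJ⟩ := hz
  refine ⟨J, fun J' hJ' => ?_⟩
  have h := (hJ J' hJ').2
  have e : ∑ j ∈ J', ⟪dev E j x, y⟫_ℝ - n * ⟪x, y⟫_ℝ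
      = ∑ j ∈ J', ⟪dev E j (x - z), dev E j y⟫_ℝ - n * ⟪x - z, y⟫_ℝ := by
    have h2 : ∑ j ∈ J', ⟪dev E j z, y⟫_ℝ = n * ⟪z, y⟫_ℝ := by
      rw [← sum_inner, h, inner_smul_left]; simp
    simp only [hE.inner_dev_dev, map_sub, inner_sub_left, Finset.sum_sub_distrib, h2]
    ring
  rw [Real.dist_eq, e]
  refine lt_of_le_of_lt ?_ hxz'
  have h3 : |∑ j ∈ J', ⟪dev E j (x - z), dev E j y⟫_ℝ|
      ≤ ‖x - z‖ * (√n * √(∑' j, ‖dev E j y‖ ^ 2)) := by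
    calc |∑ j ∈ J', ⟪dev E j (x - z), dev E j y⟫_ℝ|
        ≤ ∑ j ∈ J', ‖dev E j (x - z)‖ * ‖dev E j y‖ :=
          (Finset.abs_sum_le_sum_abs _ _).trans
            (Finset.sum_le_sum fun j _ => abs_real_inner_le_norm _ _)
      _ ≤ √(∑ j ∈ J', ‖dev E j (x - z)‖ ^ 2) * √(∑ j ∈ J', ‖dev E j y‖ ^ 2) :=
          Real.sum_mul_le_sqrt_mul_sqrt _ _ _
      _ ≤ √(n * ‖x - z‖ ^ 2) * √(∑' j, ‖dev E j y‖ ^ 2) := by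
          gcongr
          · exact hE.sum_norm_dev_sq_le hw J'
          · exact hy.sum_le_tsum _ fun _ _ => by positivity
      _ = _ := by rw [Real.sqrt_mul (by positivity), Real.sqrt_sq (norm_nonneg _)]; ring
  have h4 : |n * ⟪x - z, y⟫_ℝ| ≤ ‖x - z‖ * (n * ‖y‖) := by
    rw [abs_mul, Nat.abs_cast]
    nlinarith [abs_real_inner_le_norm (x - z) y, (Nat.cast_nonneg n : (0 : ℝ) ≤ n)]
  refine (abs_sub _ _).trans ?_
  rw [hC, mul_add]
  exact add_le_add h3 h4

/-! ### Almost orthogonal families attached to index sets of equal size. -/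

section Family

variable {n M : ℕ} {G : κ → H} {s : κ → Finset ι} (hcard : ∀ k, (s k).card = n)
  (h0 : ∀ k, ∀ j ∈ s k, E j (G k) = 0) (h1 : ∀ k, ∀ j ∉ s k, E j (G k) = G k)

include hcard h0 h1

lemma inner_eq_zero_of_ne {k l : κ} (hkl : s k ≠ s l) : ⟪G k, G l⟫_ℝ = 0 := by
  obtain ⟨j, hj, hj'⟩ : ∃ j ∈ s k, j ∉ s l := by
    by_contra! h
    exact hkl (Finset.eq_of_subset_of_card_le h (by rw [hcard, hcard]))
  rw [← h1 l j hj', ← hE.symm, h0 k j hj, inner_zero_left]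

variable [DecidableEq ι] (hM : ∀ (t : Finset κ) k, {l ∈ t | s l = s k}.card ≤ M)
include hM

/-- Each row of the Gram matrix has at most `M` entries that can be nonzero, and ab ≤ (a² + b²)/2
handles them. Exact orthogonality fails because tuples with the same set of indices interact. -/
lemma norm_sum_sq_le (t : Finset κ) : ‖∑ k ∈ t, G k‖ ^ 2 ≤ M * ∑ k ∈ t, ‖G k‖ ^ 2 := by
  have hb : ∀ k l, ⟪G k, G l⟫_ℝ ≤ if s l = s k then (‖G k‖ ^ 2 + ‖G l‖ ^ 2) / 2 else 0 :=
    fun k l => by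
      split_ifs with h
      · nlinarith [real_inner_le_norm (G k) (G l), sq_nonneg (‖G k‖ - ‖G l‖)]
      · exact (hE.inner_eq_zero_of_ne hcard h0 h1 fun h' => h h'.symm).le
  have e1 : ∀ k, ∑ l ∈ t, (if s l = s k then ‖G k‖ ^ 2 / 2 else 0) ≤ M * (‖G k‖ ^ 2 / 2) :=
    fun k => by
      rw [← Finset.sum_filter, Finset.sum_const, nsmul_eq_mul]
      exact mul_le_mul_of_nonneg_right (by exact_mod_cast hM t k) (by positivity)
  rw [← real_inner_self_eq_norm_sq, sum_inner]
  simp only [inner_sum]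
  calc ∑ k ∈ t, ∑ l ∈ t, ⟪G k, G l⟫_ℝ
      ≤ ∑ k ∈ t, ∑ l ∈ t, ((if s l = s k then ‖G k‖ ^ 2 / 2 else 0)
          + if s k = s l then ‖G l‖ ^ 2 / 2 else 0) := by
        refine Finset.sum_le_sum fun k _ => Finset.sum_le_sum fun l _ => (hb k l).trans ?_
        by_cases h : s l = s k
        · simp only [h, if_true]; linarith
        · simp [h, Ne.symm h]
    _ = ∑ k ∈ t, (∑ l ∈ t, if s l = s k then ‖G k‖ ^ 2 / 2 else 0)
          + ∑ l ∈ t, ∑ k ∈ t, if s k = s l then ‖G l‖ ^ 2 / 2 else 0 := by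
        simp only [Finset.sum_add_distrib]
        rw [Finset.sum_comm (f := fun k l => if s k = s l then ‖G l‖ ^ 2 / 2 else 0)]
    _ ≤ ∑ k ∈ t, M * (‖G k‖ ^ 2 / 2) + ∑ l ∈ t, M * (‖G l‖ ^ 2 / 2) :=
        add_le_add (Finset.sum_le_sum fun k _ => e1 k) (Finset.sum_le_sum fun l _ => e1 l)
    _ = _ := by
        rw [← Finset.sum_add_distrib, Finset.mul_sum]
        exact Finset.sum_congr rfl fun k _ => by ring

variable [CompleteSpace H] (hG : Summable fun k => ‖G k‖ ^ 2)
include hG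

lemma summable_family : Summable G := by
  rw [summable_iff_vanishing_norm]
  intro ε hε
  obtain ⟨t, ht⟩ := summable_iff_vanishing_norm.1 hG (ε ^ 2 / (M + 1)) (by positivity)
  refine ⟨t, fun u hu => ?_⟩
  have h2 := ht u hu
  rw [Real.norm_of_nonneg (Finset.sum_nonneg fun _ _ => by positivity),
    lt_div_iff₀ (by positivity)] at h2
  have h3 := hE.norm_sum_sq_le hcard h0 h1 hM u
  have h4 : (0 : ℝ) ≤ ∑ k ∈ u, ‖G k‖ ^ 2 := Finset.sum_nonneg fun _ _ => by positivity
  exact lt_of_pow_lt_pow_left₀ 2 hε.le (by linarith)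

lemma norm_tsum_sq_le : ‖∑' k, G k‖ ^ 2 ≤ M * ∑' k, ‖G k‖ ^ 2 :=
  le_of_tendsto_of_tendsto
    ((hE.summable_family hcard h0 h1 hM hG).hasSum.norm.pow 2) (hG.hasSum.const_mul (M : ℝ))
    (Eventually.of_forall fun t => hE.norm_sum_sq_le hcard h0 h1 hM t)

lemma tsum_mem_closure_finChaos : ∑' k, G k ∈ (finChaos E n).topologicalClosure :=
  mem_closure_of_tendsto (hE.summable_family hcard h0 h1 hM hG).hasSum
    (Eventually.of_forall fun t => sum_mem_finChaos hcard h0 h1 t)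

end Family

end IsProjFamily

end Hilbert

/-! ### Averaging over finitely many coordinates -/

instance : IsProbabilityMeasure prob := by unfold prob; infer_instance

/-- The sequence `ω` with the coordinates in `A` replaced by those of `ω'`. -/
def mix (A : Finset ℕ) (ω ω' : Omega) : Omega := fun j => if j ∈ A then ω' j else ω j

lemma measurable_mix (A : Finset ℕ) : Measurable fun p : Omega × Omega => mix A p.1 p.2 := by
  refine measurable_pi_lambda _ fun j => ?_
  by_cases h : j ∈ A
  · simp only [mix, h, if_true]; fun_prop
  · simp only [mix, h, if_false]; fun_prop

lemma mix_mix (A B : Finset ℕ) (ω ω' ω'' : Omega) :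
    mix A (mix B ω ω'') ω' = mix (A ∪ B) ω (mix A ω'' ω') := by
  ext j
  by_cases h : j ∈ A <;> by_cases h' : j ∈ B <;> simp [mix, h, h']

lemma mix_mix_self (A : Finset ℕ) (ω ω' ω'' : Omega) :
    mix A (mix A ω ω'') ω' = mix A ω ω' := by
  ext j
  by_cases h : j ∈ A <;> simp [mix, h]

/-- A cylinder event splits into conditions on the coordinates outside `A`, read from the first
sequence, and on those in `A`, read from the independent second one. -/
lemma measurePreserving_mix (A : Finset ℕ) :
    MeasurePreserving (fun p : Omega × Omega => mix A p.1 p.2) (prob.prod prob) prob := by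
  refine ⟨measurable_mix A, Measure.eq_infinitePi _ fun s t ht => ?_⟩
  rw [Measure.map_apply (measurable_mix A) (.pi s.countable_toSet fun _ _ => ht _)]
  have e : (fun p : Omega × Omega => mix A p.1 p.2) ⁻¹' (s : Set ℕ).pi t
      = ((↑(s \ A) : Set ℕ).pi t) ×ˢ ((↑(s ∩ A) : Set ℕ).pi t) := by
    ext p
    simp only [mem_preimage, Set.mem_pi, mem_prod, Finset.coe_sdiff, Finset.coe_inter,
      Finset.mem_coe, Set.mem_sdiff, mem_inter_iff]
    refine ⟨fun h => ⟨fun j hj => by simpa [mix, hj.2] using h j hj.1,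
      fun j hj => by simpa [mix, hj.2] using h j hj.1⟩, fun h j hj => ?_⟩
    by_cases hA : j ∈ A
    · simpa [mix, hA] using h.2 j ⟨hj, hA⟩
    · simpa [mix, hA] using h.1 j ⟨hj, hA⟩
  rw [e, Measure.prod_prod, prob, Measure.infinitePi_pi _ fun _ _ => ht _,
    Measure.infinitePi_pi _ fun _ _ => ht _, mul_comm, Finset.prod_inter_mul_prod_sdiff]

lemma integral_comp_of_measurePreserving {α β : Type*} [MeasurableSpace α] [MeasurableSpace β]
    {μ : Measure α} {ν : Measure β} {φ : α → β} (hφ : MeasurePreserving φ μ ν) {F : β → ℝ}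
    (hF : AEStronglyMeasurable F ν) : ∫ x, F (φ x) ∂μ = ∫ y, F y ∂ν := by
  rw [← hφ.map_eq] at hF ⊢
  exact (integral_map hφ.measurable.aemeasurable hF).symm

/-- The average of `X` over the coordinates in `A`. -/
def avg (A : Finset ℕ) (X : Omega → ℝ) (ω : Omega) : ℝ := ∫ ω', X (mix A ω ω') ∂prob

lemma ae_ae_mix {p : Omega → Prop} (A : Finset ℕ) (h : ∀ᵐ ω ∂prob, p ω) :
    ∀ᵐ ω ∂prob, ∀ᵐ ω' ∂prob, p (mix A ω ω') :=
  Measure.ae_ae_of_ae_prod ((measurePreserving_mix A).quasiMeasurePreserving.ae h)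

lemma avg_congr (A : Finset ℕ) {X Y : Omega → ℝ} (h : X =ᵐ[prob] Y) :
    avg A X =ᵐ[prob] avg A Y := by
  filter_upwards [ae_ae_mix A h] with ω hω
  exact integral_congr_ae hω

lemma avg_avg_mix (A : Finset ℕ) (X : Omega → ℝ) (ω ω' : Omega) :
    avg A X (mix A ω ω') = avg A X ω := by
  simp only [avg, mix_mix_self]

lemma integrable_comp_mix (A : Finset ℕ) {X : Omega → ℝ} (hX : Integrable X prob) :
    Integrable (fun p : Omega × Omega => X (mix A p.1 p.2)) (prob.prod prob) :=
  (measurePreserving_mix A).integrable_comp_of_integrable hX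

lemma ae_integrable_mix (A : Finset ℕ) {X : Omega → ℝ} (hX : Integrable X prob) :
    ∀ᵐ ω ∂prob, Integrable (fun ω' => X (mix A ω ω')) prob :=
  (integrable_comp_mix A hX).prod_right_ae

lemma ae_memLp_mix (A : Finset ℕ) {X : Omega → ℝ} (hX : MemLp X 2 prob) :
    ∀ᵐ ω ∂prob, MemLp (fun ω' => X (mix A ω ω')) 2 prob := by
  have h1 := hX.comp_measurePreserving (measurePreserving_mix A)
  filter_upwards [h1.1.prodMk_left, h1.integrable_sq.prod_right_ae] with ω h2 h3
  exact (memLp_two_iff_integrable_sq h2).2 h3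

lemma integrable_avg (A : Finset ℕ) {X : Omega → ℝ} (hX : Integrable X prob) :
    Integrable (avg A X) prob :=
  (integrable_comp_mix A hX).integral_prod_left

lemma integral_avg (A : Finset ℕ) {X : Omega → ℝ} (hX : Integrable X prob) :
    ∫ ω, avg A X ω ∂prob = ∫ ω, X ω ∂prob := by
  simp only [avg]
  rw [← integral_prod _ (integrable_comp_mix A hX)]
  exact integral_comp_of_measurePreserving (measurePreserving_mix A) hX.1

lemma sq_integral_le_integral_sq {Ω : Type*} [MeasurableSpace Ω] {μ : Measure Ω}
    [IsProbabilityMeasure μ] {X : Ω → ℝ} (hX : MemLp X 2 μ) :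
    (∫ ω, X ω ∂μ) ^ 2 ≤ ∫ ω, X ω ^ 2 ∂μ := by
  have h1 := variance_nonneg X μ
  rw [variance_eq_sub hX] at h1
  simpa using h1

lemma memLp_avg (A : Finset ℕ) {X : Omega → ℝ} (hX : MemLp X 2 prob) : MemLp (avg A X) 2 prob := by
  have h1 := hX.integrable (by norm_num)
  refine (memLp_two_iff_integrable_sq (integrable_avg A h1).1).2 ?_
  refine (integrable_avg A hX.integrable_sq).mono' ((integrable_avg A h1).1.pow 2) ?_
  filter_upwards [ae_memLp_mix A hX] with ω hω
  rw [Real.norm_of_nonneg (sq_nonneg _)]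
  exact sq_integral_le_integral_sq hω

lemma avg_avg (A B : Finset ℕ) {X : Omega → ℝ} (hX : Integrable X prob) :
    avg B (avg A X) =ᵐ[prob] avg (A ∪ B) X := by
  filter_upwards [ae_integrable_mix (A ∪ B) hX] with ω hω
  simp only [avg, mix_mix]
  have h := (measurePreserving_mix A).integrable_comp_of_integrable hω
  rw [← integral_prod (fun p : Omega × Omega => X (mix (A ∪ B) ω (mix A p.1 p.2))) h]
  exact integral_comp_of_measurePreserving (measurePreserving_mix A) hω.1

/-- The function `avg A Y` does not depend on the coordinates in `A`, so it can be pulled out when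
the product is averaged over them. This is the self-adjointness of the averaging operators. -/
lemma integral_mul_avg (A : Finset ℕ) {X Y : Omega → ℝ} (hX : MemLp X 2 prob)
    (hY : MemLp Y 2 prob) :
    ∫ ω, X ω * avg A Y ω ∂prob = ∫ ω, avg A X ω * avg A Y ω ∂prob := by
  have h := integral_avg A (hX.integrable_mul (memLp_avg A hY))
  simp only [Pi.mul_apply] at h
  rw [← h]
  simp only [avg, Pi.mul_apply]
  refine integral_congr_ae (ae_of_all _ fun ω => ?_)
  have := avg_avg_mix A Y ω
  simp only [avg] at this
  simp only [this, integral_mul_const]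

open scoped InnerProductSpace

/-- Averaging over the coordinates in `A`, as an operator on `L²`. -/
def avgL (A : Finset ℕ) : Lp ℝ 2 prob →ₗ[ℝ] Lp ℝ 2 prob where
  toFun f := (memLp_avg A (Lp.memLp f)).toLp
  map_add' f g := by
    apply Lp.ext
    have hf := ae_integrable_mix A ((Lp.memLp f).integrable (by norm_num))
    have hg := ae_integrable_mix A ((Lp.memLp g).integrable (by norm_num))
    filter_upwards [MemLp.coeFn_toLp (memLp_avg A (Lp.memLp (f + g))),
      Lp.coeFn_add ((memLp_avg A (Lp.memLp f)).toLp) ((memLp_avg A (Lp.memLp g)).toLp),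
      MemLp.coeFn_toLp (memLp_avg A (Lp.memLp f)), MemLp.coeFn_toLp (memLp_avg A (Lp.memLp g)),
      avg_congr A (Lp.coeFn_add f g), hf, hg] with ω h1 h2 h3 h4 h5 h6 h7
    rw [h1, h2, Pi.add_apply, h3, h4, h5]
    exact integral_add h6 h7
  map_smul' c f := by
    apply Lp.ext
    filter_upwards [MemLp.coeFn_toLp (memLp_avg A (Lp.memLp (c • f))),
      Lp.coeFn_smul c ((memLp_avg A (Lp.memLp f)).toLp),
      MemLp.coeFn_toLp (memLp_avg A (Lp.memLp f)), avg_congr A (Lp.coeFn_smul c f)]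
      with ω h1 h2 h3 h5
    rw [RingHom.id_apply, h1, h2, Pi.smul_apply, h3, h5]
    exact integral_const_mul c _

lemma coeFn_avgL (A : Finset ℕ) (f : Lp ℝ 2 prob) : avgL A f =ᵐ[prob] avg A f :=
  MemLp.coeFn_toLp (memLp_avg A (Lp.memLp f))

lemma avgL_toLp (A : Finset ℕ) {X : Omega → ℝ} (hX : MemLp X 2 prob) :
    avgL A hX.toLp = (memLp_avg A hX).toLp := by
  apply Lp.ext
  filter_upwards [coeFn_avgL A hX.toLp, avg_congr A hX.coeFn_toLp,
    (memLp_avg A hX).coeFn_toLp] with ω h1 h2 h3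
  rw [h1, h2, h3]

lemma avgL_avgL (A B : Finset ℕ) (f : Lp ℝ 2 prob) : avgL B (avgL A f) = avgL (A ∪ B) f := by
  apply Lp.ext
  filter_upwards [coeFn_avgL B (avgL A f), avg_congr B (coeFn_avgL A f), coeFn_avgL (A ∪ B) f,
    avg_avg A B ((Lp.memLp f).integrable (by norm_num))] with ω h1 h2 h3 h4
  rw [h1, h2, h3, h4]

lemma inner_eq_integral {Ω : Type*} [MeasurableSpace Ω] {μ : Measure Ω} (f g : Lp ℝ 2 μ) :
    ⟪f, g⟫_ℝ = ∫ ω, f ω * g ω ∂μ := by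
  rw [L2.inner_def]
  exact integral_congr_ae (ae_of_all _ fun ω => by simp [mul_comm])

lemma inner_avgL_avgL (A : Finset ℕ) (f g : Lp ℝ 2 prob) :
    ⟪avgL A f, avgL A g⟫_ℝ = ⟪f, avgL A g⟫_ℝ := by
  simp only [inner_eq_integral]
  have h := integral_mul_avg A (Lp.memLp f) (Lp.memLp g)
  trans ∫ ω, avg A f ω * avg A g ω ∂prob
  · refine integral_congr_ae ?_
    filter_upwards [coeFn_avgL A f, coeFn_avgL A g] with ω h1 h2
    rw [h1, h2]
  · rw [← h]
    refine integral_congr_ae ?_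
    filter_upwards [coeFn_avgL A g] with ω h2
    rw [h2]

lemma isProjFamily_avgL : IsProjFamily avgL where
  symm A f g := by
    rw [← inner_avgL_avgL A f g, real_inner_comm, ← inner_avgL_avgL A g f, real_inner_comm]
  idem A f := by rw [avgL_avgL, Finset.union_self]

/-- Averaging over one coordinate. -/
def avgOne (j : ℕ) : Lp ℝ 2 prob →ₗ[ℝ] Lp ℝ 2 prob := avgL {j}

lemma isProjFamily_avgOne : IsProjFamily avgOne :=
  ⟨fun j => isProjFamily_avgL.symm {j}, fun j => isProjFamily_avgL.idem {j}⟩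

/-- The projection of `f` on the functions with vanishing averages over every coordinate in `S`,
by inclusion and exclusion. -/
def hoeffding (S : Finset ℕ) : Lp ℝ 2 prob →ₗ[ℝ] Lp ℝ 2 prob :=
  ∑ A ∈ S.powerset, ((-1 : ℝ) ^ A.card) • avgL A

lemma hoeffding_apply (S : Finset ℕ) (f : Lp ℝ 2 prob) :
    hoeffding S f = ∑ A ∈ S.powerset, ((-1 : ℝ) ^ A.card) • avgL A f := by
  simp [hoeffding]

/-- Pair each subset A not containing j with A ∪ {j}: averaging over j makes the two terms equal,
and their signs are opposite. -/
lemma avgOne_hoeffding_of_mem {S : Finset ℕ} {j : ℕ} (hj : j ∈ S) (f : Lp ℝ 2 prob) :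
    avgOne j (hoeffding S f) = 0 := by
  rw [hoeffding_apply, ← Finset.insert_erase hj, Finset.sum_powerset_insert (Finset.notMem_erase j S),
    ← Finset.sum_add_distrib, map_sum]
  refine Finset.sum_eq_zero fun A hA => ?_
  have hA' : j ∉ A := fun h => Finset.notMem_erase j S (Finset.mem_powerset.1 hA h)
  rw [Finset.card_insert_of_notMem hA', map_add, map_smul, map_smul, avgOne, avgL_avgL, avgL_avgL]
  have : insert j A ∪ {j} = A ∪ {j} := by
    ext; simp
  rw [this, pow_succ]
  simp

lemma avgOne_hoeffding_of_fixed (S : Finset ℕ) {j : ℕ} {f : Lp ℝ 2 prob} (hf : avgOne j f = f) :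
    avgOne j (hoeffding S f) = hoeffding S f := by
  rw [hoeffding_apply, map_sum]
  refine Finset.sum_congr rfl fun A _ => ?_
  rw [map_smul, avgOne, avgL_avgL, Finset.union_comm, ← avgL_avgL]
  congr 2

lemma norm_hoeffding_le (S : Finset ℕ) (f : Lp ℝ 2 prob) :
    ‖hoeffding S f‖ ≤ 2 ^ S.card * ‖f‖ := by
  rw [hoeffding_apply]
  refine (norm_sum_le _ _).trans ?_
  calc ∑ A ∈ S.powerset, ‖((-1 : ℝ) ^ A.card) • avgL A f‖ ≤ ∑ A ∈ S.powerset, ‖f‖ := by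
        refine Finset.sum_le_sum fun A _ => ?_
        rw [norm_smul, norm_pow, norm_neg, norm_one, one_pow, one_mul]
        exact isProjFamily_avgL.norm_apply_le A f
    _ = _ := by simp

lemma avgOne_toLp_of_fixed {j : ℕ} {X : Omega → ℝ} (hX : MemLp X 2 prob)
    (h : ∀ ω ω', X (mix {j} ω ω') = X ω) : avgOne j hX.toLp = hX.toLp := by
  rw [avgOne, avgL_toLp]
  congr 1
  ext ω
  simp [avg, h]

/-! ### The chaos expansion attached to a square-integrable kernel -/

/-- The half-open block `[2j, 2j+2)`. -/
def block (j : ℕ) : Set ℝ := Ico (2 * (j : ℝ)) (2 * (j : ℝ) + 2)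

/-- A product of half-open blocks. -/
def box {m : ℕ} (k : Fin m → ℕ) : Set (Fin m → ℝ) := Set.pi univ fun i => block (k i)

/-- The point with coordinates `2kᵢ + 1 + U_{kᵢ}`. -/
def jumpTimes {m : ℕ} (k : Fin m → ℕ) (ω : Omega) : Fin m → ℝ :=
  fun i => 2 * (k i : ℝ) + 1 + ω (k i)

lemma measurableSet_block (j : ℕ) : MeasurableSet (block j) := measurableSet_Ico

lemma measurableSet_box {m : ℕ} (k : Fin m → ℕ) : MeasurableSet (box k) :=
  MeasurableSet.univ_pi fun i => measurableSet_block (k i)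

lemma measurable_jumpTimes {m : ℕ} (k : Fin m → ℕ) : Measurable (jumpTimes k) := by
  unfold jumpTimes
  fun_prop

lemma mem_block_iff {t : ℝ} (ht : 0 ≤ t) {j : ℕ} : t ∈ block j ↔ ⌊t / 2⌋₊ = j := by
  rw [Nat.floor_eq_iff (by positivity), block, mem_Ico]
  constructor <;> rintro ⟨h1, h2⟩ <;> constructor <;> linarith

lemma block_subset_Ici (j : ℕ) : block j ⊆ Ici 0 := fun t ht =>
  le_trans (by positivity) ht.1

lemma iUnion_block : ⋃ j, block j = Ici 0 := by
  ext t
  simp only [mem_iUnion]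
  refine ⟨fun ⟨j, hj⟩ => block_subset_Ici j hj, fun ht => ⟨⌊t / 2⌋₊, (mem_block_iff ht).2 rfl⟩⟩

lemma eq_of_mem_block {t : ℝ} {i j : ℕ} (hi : t ∈ block i) (hj : t ∈ block j) : i = j := by
  rw [← (mem_block_iff (block_subset_Ici i hi)).1 hi, ← (mem_block_iff (block_subset_Ici j hj)).1 hj]

lemma pairwise_disjoint_block : Pairwise (Function.onFun Disjoint block) := fun _ _ hij =>
  Set.disjoint_left.2 fun _ hi hj => hij (eq_of_mem_block hi hj)

lemma disjoint_box {m : ℕ} {k l : Fin m → ℕ} (h : k ≠ l) : Disjoint (box k) (box l) := by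
  refine Set.disjoint_left.2 fun x hx hy => h ?_
  ext i
  exact eq_of_mem_block (hx i trivial) (hy i trivial)

lemma leb_restrict_block (j : ℕ) : leb.restrict (block j) = volume.restrict (block j) :=
  Measure.restrict_restrict_of_subset (block_subset_Ici j)

lemma unif_eq : unif = (2⁻¹ : ℝ≥0∞) • volume.restrict (Icc (-1 : ℝ) 1) := by
  rw [unif, ProbabilityTheory.cond, Real.volume_Icc]
  congr
  norm_num

lemma map_unif (j : ℕ) :
    unif.map (fun u => 2 * (j : ℝ) + 1 + u) = (2⁻¹ : ℝ≥0∞) • volume.restrict (block j) := by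
  have h := (measurePreserving_add_left (volume : Measure ℝ) (2 * (j : ℝ) + 1)).restrict_preimage
    (measurableSet_Icc (a := 2 * (j : ℝ)) (b := 2 * (j : ℝ) + 2))
  have e : (fun u => 2 * (j : ℝ) + 1 + u) ⁻¹' Icc (2 * (j : ℝ)) (2 * (j : ℝ) + 2)
      = Icc (-1 : ℝ) 1 := by
    ext u
    simp only [mem_preimage, mem_Icc]
    constructor <;> rintro ⟨h1, h2⟩ <;> constructor <;> linarith
  rw [e] at h
  rw [unif_eq, Measure.map_smul, h.map_eq, block, restrict_Ico_eq_restrict_Icc]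

/-- Distinct indices make the jump times independent, each uniform on its block; every block
contributes a density 1/2. -/
lemma map_jumpTimes {m : ℕ} (k : Fin m ↪ ℕ) :
    prob.map (jumpTimes k) = ((2⁻¹ : ℝ≥0∞) ^ m) • (lebPi m).restrict (box k) := by
  have : ∀ i, IsProbabilityMeasure ((2⁻¹ : ℝ≥0∞) • (volume : Measure ℝ).restrict (block (k i))) :=
    fun i => by
      rw [← map_unif]
      exact Measure.isProbabilityMeasure_map (by fun_prop)
  have h1 : Measure.pi (fun i => (2⁻¹ : ℝ≥0∞) • volume.restrict (block (k i)))
      = prob.map (jumpTimes k) := by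
    refine Measure.pi_eq fun s hs => ?_
    let t : ℕ → Set ℝ := Function.extend k (fun i => (fun u => 2 * (k i : ℝ) + 1 + u) ⁻¹' s i)
      fun _ => univ
    have ht : ∀ i, t (k i) = (fun u => 2 * (k i : ℝ) + 1 + u) ⁻¹' s i := fun i =>
      k.injective.extend_apply _ _ i
    have e : jumpTimes k ⁻¹' (univ.pi s) = (↑(Finset.univ.map k) : Set ℕ).pi t := by
      ext ω
      simp [jumpTimes, Set.mem_pi, ht]
    rw [Measure.map_apply (measurable_jumpTimes k) (MeasurableSet.univ_pi hs), e, prob,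
      Measure.infinitePi_pi, Finset.prod_map]
    · refine Finset.prod_congr rfl fun i _ => ?_
      rw [ht, ← map_unif, Measure.map_apply (by fun_prop) (hs i)]
    · simp only [Finset.mem_map, Finset.mem_univ, true_and, forall_exists_index,
        forall_apply_eq_imp_iff, ht]
      exact fun i => (measurable_const_add _) (hs i)
  have h2 : Measure.pi (fun i => (2⁻¹ : ℝ≥0∞) • volume.restrict (block (k i)))
      = ((2⁻¹ : ℝ≥0∞) ^ m) • (lebPi m).restrict (box k) := by
    refine Measure.pi_eq fun s hs => ?_
    rw [lebPi, box, Measure.restrict_pi_pi, Measure.smul_apply, Measure.pi_pi]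
    simp only [leb_restrict_block, Measure.smul_apply, smul_eq_mul, Finset.prod_mul_distrib,
      Finset.prod_const, Finset.card_univ, Fintype.card_fin]
  rw [← h1, h2]

lemma quasiMeasurePreserving_jumpTimes {m : ℕ} (k : Fin m ↪ ℕ) :
    Measure.QuasiMeasurePreserving (jumpTimes k) prob (lebPi m) := by
  refine ⟨measurable_jumpTimes k, ?_⟩
  rw [map_jumpTimes]
  exact (Measure.smul_absolutelyContinuous).trans Measure.restrict_le_self.absolutelyContinuous

/-! ### Kernels evaluated at the jump times and the resulting L² operator. -/

section Kernel

variable {n : ℕ}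

lemma memLp_comp_jumpTimes (k : Fin n ↪ ℕ) {f : (Fin n → ℝ) → ℝ} {p : ℝ≥0∞}
    (hf : MemLp f p (lebPi n)) : MemLp (fun ω => f (jumpTimes k ω)) p prob := by
  have h : MemLp f p (prob.map (jumpTimes k)) := by
    rw [map_jumpTimes]
    exact (hf.restrict _).smul_measure (ENNReal.pow_ne_top (by simp))
  exact h.comp_of_map (measurable_jumpTimes k).aemeasurable

lemma integral_comp_jumpTimes (k : Fin n ↪ ℕ) {f : (Fin n → ℝ) → ℝ}
    (hf : AEStronglyMeasurable f (lebPi n)) :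
    ∫ ω, f (jumpTimes k ω) ∂prob = (1 / 2) ^ n * ∫ x in box k, f x ∂(lebPi n) := by
  have hf' : AEStronglyMeasurable f (prob.map (jumpTimes k)) := by
    rw [map_jumpTimes]
    exact hf.restrict.smul_measure _
  rw [← integral_map (measurable_jumpTimes k).aemeasurable hf', map_jumpTimes,
    integral_smul_measure]
  simp

/-- Evaluation of a kernel at the jump times, as an operator from `L²(ℝ₊ⁿ)` to `L²(Ω)`. -/
def evalJump (k : Fin n ↪ ℕ) : Lp ℝ 2 (lebPi n) →ₗ[ℝ] Lp ℝ 2 prob where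
  toFun f := (memLp_comp_jumpTimes k (Lp.memLp f)).toLp
  map_add' f g := by
    rw [← MemLp.toLp_add, MemLp.toLp_eq_toLp_iff]
    exact (quasiMeasurePreserving_jumpTimes k).ae_eq_comp (Lp.coeFn_add f g)
  map_smul' c f := by
    rw [RingHom.id_apply, ← MemLp.toLp_const_smul, MemLp.toLp_eq_toLp_iff]
    exact (quasiMeasurePreserving_jumpTimes k).ae_eq_comp (Lp.coeFn_smul c f)

lemma evalJump_toLp (k : Fin n ↪ ℕ) {f : (Fin n → ℝ) → ℝ} (hf : MemLp f 2 (lebPi n)) :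
    evalJump k hf.toLp = (memLp_comp_jumpTimes k hf).toLp := by
  simp only [evalJump, LinearMap.coe_mk, AddHom.coe_mk]
  rw [MemLp.toLp_eq_toLp_iff]
  exact (quasiMeasurePreserving_jumpTimes k).ae_eq_comp hf.coeFn_toLp

lemma norm_sq_eq_integral {Ω : Type*} [MeasurableSpace Ω] {μ : Measure Ω} (f : Lp ℝ 2 μ) :
    ‖f‖ ^ 2 = ∫ ω, f ω ^ 2 ∂μ := by
  rw [← real_inner_self_eq_norm_sq, inner_eq_integral]
  simp only [sq]

lemma norm_evalJump_sq (k : Fin n ↪ ℕ) (f : Lp ℝ 2 (lebPi n)) :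
    ‖evalJump k f‖ ^ 2 = (1 / 2) ^ n * ∫ x in box k, f x ^ 2 ∂(lebPi n) := by
  rw [norm_sq_eq_integral, ← integral_comp_jumpTimes k (f := fun x => f x ^ 2)
    ((Lp.aestronglyMeasurable f).pow 2)]
  refine integral_congr_ae ?_
  filter_upwards [(memLp_comp_jumpTimes k (Lp.memLp f)).coeFn_toLp] with ω hω
  rw [← hω]
  rfl

instance {m : ℕ} : Countable (Fin m ↪ ℕ) := DFunLike.coe_injective.countable

lemma hasSum_setIntegral_box {f : (Fin n → ℝ) → ℝ} (hf : Integrable f (lebPi n)) :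
    HasSum (fun k : Fin n ↪ ℕ => ∫ x in box k, f x ∂(lebPi n))
      (∫ x in ⋃ k : Fin n ↪ ℕ, box k, f x ∂(lebPi n)) :=
  hasSum_integral_iUnion (fun k => measurableSet_box k)
    (fun _ _ h => disjoint_box fun h' => h (DFunLike.coe_injective h')) hf.integrableOn

lemma summable_norm_evalJump_sq (f : Lp ℝ 2 (lebPi n)) :
    Summable fun k : Fin n ↪ ℕ => ‖evalJump k f‖ ^ 2 := by
  simp only [norm_evalJump_sq]
  exact (hasSum_setIntegral_box (Lp.memLp f).integrable_sq).summable.mul_left _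

lemma tsum_norm_evalJump_sq_le (f : Lp ℝ 2 (lebPi n)) :
    ∑' k : Fin n ↪ ℕ, ‖evalJump k f‖ ^ 2 ≤ ‖f‖ ^ 2 := by
  simp only [norm_evalJump_sq]
  rw [tsum_mul_left, (hasSum_setIntegral_box (Lp.memLp f).integrable_sq).tsum_eq,
    norm_sq_eq_integral]
  have h1 : ∫ x in ⋃ k : Fin n ↪ ℕ, box k, f x ^ 2 ∂(lebPi n) ≤ ∫ x, f x ^ 2 ∂(lebPi n) :=
    setIntegral_le_integral (Lp.memLp f).integrable_sq (ae_of_all _ fun _ => sq_nonneg _)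
  have h2 : (0 : ℝ) ≤ ∫ x in ⋃ k : Fin n ↪ ℕ, box k, f x ^ 2 ∂(lebPi n) :=
    integral_nonneg fun _ => sq_nonneg _
  exact (mul_le_of_le_one_left h2 (pow_le_one₀ (by norm_num) (by norm_num))).trans h1

/-- The set of indices of a tuple. -/
def indices (k : Fin n ↪ ℕ) : Finset ℕ := Finset.univ.map k

lemma card_indices (k : Fin n ↪ ℕ) : (indices k).card = n := by simp [indices]

lemma mem_indices {k : Fin n ↪ ℕ} {j : ℕ} : j ∈ indices k ↔ ∃ i, k i = j := by simp [indices]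

/-- A tuple with the given index set is a map from `Fin n` into a set of n elements. The crude count
n^n suffices, as only continuity is needed. -/
lemma card_filter_indices_le (t : Finset (Fin n ↪ ℕ)) (k : Fin n ↪ ℕ) :
    {l ∈ t | indices l = indices k}.card ≤ n ^ n := by
  classical
  have h : {l ∈ t | indices l = indices k}.card
      ≤ (Fintype.piFinset fun _ : Fin n => indices k).card := by
    refine Finset.card_le_card_of_injOn (fun l => ⇑l) (fun l hl => ?_)
      DFunLike.coe_injective.injOn
    rw [Finset.mem_coe, Finset.mem_filter] at hl
    rw [Finset.mem_coe, Fintype.mem_piFinset]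
    intro i
    rw [← hl.2]
    exact mem_indices.2 ⟨i, rfl⟩
  simpa [card_indices] using h

lemma jumpTimes_mix_of_notMem {k : Fin n ↪ ℕ} {j : ℕ} (hj : j ∉ indices k) (ω ω' : Omega) :
    jumpTimes k (mix {j} ω ω') = jumpTimes k ω := by
  ext i
  have : k i ≠ j := fun h => hj (mem_indices.2 ⟨i, h⟩)
  simp [jumpTimes, mix, this]

/-- The completely degenerate part of a kernel evaluated at the jump times. -/
def chaosTerm (k : Fin n ↪ ℕ) : Lp ℝ 2 (lebPi n) →ₗ[ℝ] Lp ℝ 2 prob :=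
  hoeffding (indices k) ∘ₗ evalJump k

lemma avgOne_chaosTerm_of_mem {k : Fin n ↪ ℕ} {j : ℕ} (hj : j ∈ indices k)
    (f : Lp ℝ 2 (lebPi n)) : avgOne j (chaosTerm k f) = 0 :=
  avgOne_hoeffding_of_mem hj _

lemma avgOne_chaosTerm_of_notMem {k : Fin n ↪ ℕ} {j : ℕ} (hj : j ∉ indices k)
    (f : Lp ℝ 2 (lebPi n)) : avgOne j (chaosTerm k f) = chaosTerm k f :=
  avgOne_hoeffding_of_fixed _ (avgOne_toLp_of_fixed (memLp_comp_jumpTimes k (Lp.memLp f)) fun ω ω' => by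
    rw [jumpTimes_mix_of_notMem hj])

lemma norm_chaosTerm_sq_le (k : Fin n ↪ ℕ) (f : Lp ℝ 2 (lebPi n)) :
    ‖chaosTerm k f‖ ^ 2 ≤ 4 ^ n * ‖evalJump k f‖ ^ 2 := by
  have h := norm_hoeffding_le (indices k) (evalJump k f)
  rw [card_indices] at h
  calc ‖chaosTerm k f‖ ^ 2 ≤ (2 ^ n * ‖evalJump k f‖) ^ 2 := by gcongr; exact h
    _ = _ := by rw [mul_pow, ← pow_mul, mul_comm n 2, pow_mul]; norm_num

lemma summable_norm_chaosTerm_sq (f : Lp ℝ 2 (lebPi n)) :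
    Summable fun k : Fin n ↪ ℕ => ‖chaosTerm k f‖ ^ 2 :=
  Summable.of_nonneg_of_le (fun _ => by positivity) (fun k => norm_chaosTerm_sq_le k f)
    ((summable_norm_evalJump_sq f).mul_left _)

lemma summable_chaosTerm (f : Lp ℝ 2 (lebPi n)) :
    Summable fun k : Fin n ↪ ℕ => chaosTerm k f :=
  isProjFamily_avgOne.summable_family card_indices
    (fun _ _ hj => avgOne_chaosTerm_of_mem hj f) (fun _ _ hj => avgOne_chaosTerm_of_notMem hj f)
    card_filter_indices_le (summable_norm_chaosTerm_sq f)

/-- The multiple stochastic integral as an operator from `L²(ℝ₊ⁿ)` to `L²(Ω)`. -/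
def multIntL (n : ℕ) : Lp ℝ 2 (lebPi n) →ₗ[ℝ] Lp ℝ 2 prob where
  toFun f := ∑' k : Fin n ↪ ℕ, chaosTerm k f
  map_add' f g := by
    simp only [map_add]
    exact (summable_chaosTerm f).tsum_add (summable_chaosTerm g)
  map_smul' c f := by
    simp only [map_smul, RingHom.id_apply]
    exact (summable_chaosTerm f).tsum_const_smul c

lemma hasSum_multIntL (f : Lp ℝ 2 (lebPi n)) :
    HasSum (fun k : Fin n ↪ ℕ => chaosTerm k f) (multIntL n f) :=
  (summable_chaosTerm f).hasSum

lemma multIntL_mem_closure_finChaos (f : Lp ℝ 2 (lebPi n)) :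
    multIntL n f ∈ (finChaos avgOne n).topologicalClosure :=
  isProjFamily_avgOne.tsum_mem_closure_finChaos card_indices
    (fun _ _ hj => avgOne_chaosTerm_of_mem hj f) (fun _ _ hj => avgOne_chaosTerm_of_notMem hj f)
    card_filter_indices_le (summable_norm_chaosTerm_sq f)

/-- The factor n^n comes from almost orthogonality and 4^n from the 2^n terms of inclusion and
exclusion, squared. The constant is not sharp and serves only for continuity. -/
lemma norm_multIntL_sq_le (f : Lp ℝ 2 (lebPi n)) :
    ‖multIntL n f‖ ^ 2 ≤ (n ^ n * 4 ^ n : ℝ) * ‖f‖ ^ 2 := by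
  have h := isProjFamily_avgOne.norm_tsum_sq_le card_indices
    (fun _ _ hj => avgOne_chaosTerm_of_mem hj f) (fun _ _ hj => avgOne_chaosTerm_of_notMem hj f)
    card_filter_indices_le (summable_norm_chaosTerm_sq f)
  refine h.trans ?_
  push_cast
  rw [mul_assoc]
  gcongr
  calc ∑' k : Fin n ↪ ℕ, ‖chaosTerm k f‖ ^ 2
      ≤ ∑' k : Fin n ↪ ℕ, 4 ^ n * ‖evalJump k f‖ ^ 2 :=
        (summable_norm_chaosTerm_sq f).tsum_le_tsum (fun k => norm_chaosTerm_sq_le k f)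
          ((summable_norm_evalJump_sq f).mul_left _)
    _ ≤ _ := by
        rw [tsum_mul_left]
        exact mul_le_mul_of_nonneg_left (tsum_norm_evalJump_sq_le f) (by positivity)

lemma continuous_multIntL : Continuous (multIntL n) := by
  refine ((multIntL n).mkContinuous √(n ^ n * 4 ^ n : ℝ) fun f => ?_).continuous
  rw [← Real.sqrt_sq (norm_nonneg f), ← Real.sqrt_mul (by positivity)]
  exact Real.le_sqrt_of_sq_le (norm_multIntL_sq_le f)

end Kernel

/-! ### Splitting a point of `ℝ₊ⁿ` into its first `r` and its last `n - r` coordinates -/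

section Glue

variable {α : Type*} {n r : ℕ}

/-- The tuple whose first `r` entries are those of `x` and whose last ones are those of `y`. -/
def glue (n r : ℕ) (x : Fin r → α) (y : Fin (n - r) → α) : Fin n → α :=
  fun i => if h : (i : ℕ) < r then x ⟨i, h⟩ else y ⟨(i : ℕ) - r, by have := i.isLt; omega⟩

/-- Positions of the first and of the last entries. -/
def splitEquiv (hr : r ≤ n) : Fin r ⊕ Fin (n - r) ≃ Fin n :=
  finSumFinEquiv.trans (finCongr (by omega))

lemma splitEquiv_inl (hr : r ≤ n) (i : Fin r) : (splitEquiv hr (Sum.inl i) : ℕ) = i := by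
  simp [splitEquiv]

lemma splitEquiv_inr (hr : r ≤ n) (i : Fin (n - r)) : (splitEquiv hr (Sum.inr i) : ℕ) = r + i := by
  simp [splitEquiv]

lemma glue_inl (hr : r ≤ n) (x : Fin r → α) (y : Fin (n - r) → α) (i : Fin r) :
    glue n r x y (splitEquiv hr (Sum.inl i)) = x i := by
  simp [glue, splitEquiv_inl]

lemma glue_inr (hr : r ≤ n) (x : Fin r → α) (y : Fin (n - r) → α) (i : Fin (n - r)) :
    glue n r x y (splitEquiv hr (Sum.inr i)) = y i := by
  simp [glue, splitEquiv_inr]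

/-- Gluing as an equivalence. -/
def glueEquiv (hr : r ≤ n) : (Fin r → α) × (Fin (n - r) → α) ≃ (Fin n → α) where
  toFun p := glue n r p.1 p.2
  invFun c := (fun i => c (splitEquiv hr (Sum.inl i)), fun i => c (splitEquiv hr (Sum.inr i)))
  left_inv p := by ext i <;> simp [glue_inl, glue_inr]
  right_inv c := by
    ext i
    obtain ⟨j, rfl⟩ := (splitEquiv hr).surjective i
    cases j with
    | inl j => exact glue_inl hr _ _ j
    | inr j => exact glue_inr hr _ _ j

lemma forall_fin_split (hr : r ≤ n) {p : Fin n → Prop} :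
    (∀ i, p i) ↔ (∀ i, p (splitEquiv hr (Sum.inl i))) ∧ ∀ i, p (splitEquiv hr (Sum.inr i)) := by
  rw [← (splitEquiv hr).forall_congr_right]
  simp only [Sum.forall]

lemma glue_mem_box (hr : r ≤ n) {k : Fin r → ℕ} {m : Fin (n - r) → ℕ} {x : Fin r → ℝ}
    {y : Fin (n - r) → ℝ} (hx : x ∈ box k) (hy : y ∈ box m) :
    glue n r x y ∈ box (glue n r k m) := by
  have := (forall_fin_split hr (p := fun i => glue n r x y i ∈ block (glue n r k m i))).2
    ⟨fun i => by rw [glue_inl, glue_inl]; exact hx i trivial,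
      fun i => by rw [glue_inr, glue_inr]; exact hy i trivial⟩
  exact fun i _ => this i

lemma injective_of_glue_injective (hr : r ≤ n) {k : Fin r → α} {m : Fin (n - r) → α}
    (h : Function.Injective (glue n r k m)) : Function.Injective k ∧ Function.Injective m ∧
      ∀ i j, k i ≠ m j := by
  refine ⟨fun i j hij => ?_, fun i j hij => ?_, fun i j hij => ?_⟩
  · rw [← glue_inl hr k m, ← glue_inl hr k m] at hij
    simpa using h hij
  · rw [← glue_inr hr k m, ← glue_inr hr k m] at hij
    simpa using h hij
  · rw [← glue_inl hr k m, ← glue_inr hr k m] at hij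
    simpa using h hij

lemma measurable_glue (n r : ℕ) :
    Measurable fun p : (Fin r → ℝ) × (Fin (n - r) → ℝ) => glue n r p.1 p.2 := by
  refine measurable_pi_lambda _ fun i => ?_
  unfold glue
  split_ifs <;> fun_prop

lemma measurePreserving_glue (hr : r ≤ n) :
    MeasurePreserving (fun p : (Fin r → ℝ) × (Fin (n - r) → ℝ) => glue n r p.1 p.2)
      ((lebPi r).prod (lebPi (n - r))) (lebPi n) := by
  refine ⟨measurable_glue n r, (Measure.pi_eq fun s hs => ?_).symm⟩
  rw [Measure.map_apply (measurable_glue n r) (MeasurableSet.univ_pi hs)]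
  have e : (fun p : (Fin r → ℝ) × (Fin (n - r) → ℝ) => glue n r p.1 p.2) ⁻¹' univ.pi s
      = (univ.pi fun i => s (splitEquiv hr (Sum.inl i))) ×ˢ
        (univ.pi fun i => s (splitEquiv hr (Sum.inr i))) := by
    ext p
    simp only [mem_preimage, mem_univ_pi, mem_prod]
    rw [forall_fin_split hr]
    simp only [glue_inl, glue_inr]
  rw [e, Measure.prod_prod, Measure.pi_pi, Measure.pi_pi, ← (splitEquiv hr).prod_comp,
    Fintype.prod_sum_type]

end Glue

section JumpGlue

lemma measurePreserving_jumpTimes_prod (n : ℕ) {r : ℕ} (k : Fin r ↪ ℕ) :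
    MeasurePreserving (Prod.map (jumpTimes k) id) (prob.prod (lebPi (n - r)))
      ((prob.map (jumpTimes k)).prod (lebPi (n - r))) :=
  (measurable_jumpTimes k).measurePreserving prob |>.prod (MeasurePreserving.id _)

variable {n r : ℕ} (hr : r ≤ n) (k : Fin r ↪ ℕ)
include hr

lemma quasiMeasurePreserving_jumpTimes_glue :
    Measure.QuasiMeasurePreserving
      (fun p : Omega × (Fin (n - r) → ℝ) => glue n r (jumpTimes k p.1) p.2)
      (prob.prod (lebPi (n - r))) (lebPi n) := by
  have h1 : Measure.QuasiMeasurePreserving (Prod.map (jumpTimes k) id)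
      (prob.prod (lebPi (n - r))) ((lebPi r).prod (lebPi (n - r))) := by
    refine (measurePreserving_jumpTimes_prod n k).quasiMeasurePreserving.mono_right ?_
    exact (quasiMeasurePreserving_jumpTimes k).absolutelyContinuous.prod .rfl
  exact (measurePreserving_glue hr).quasiMeasurePreserving.comp h1

lemma integrable_jumpTimes_glue {g : (Fin n → ℝ) → ℝ} (hg : Integrable g (lebPi n)) :
    Integrable (fun p : Omega × (Fin (n - r) → ℝ) => g (glue n r (jumpTimes k p.1) p.2))
      (prob.prod (lebPi (n - r))) := by
  have h1 := (measurePreserving_glue hr).integrable_comp_of_integrable hg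
  have h2 : Integrable (fun p : (Fin r → ℝ) × (Fin (n - r) → ℝ) => g (glue n r p.1 p.2))
      ((prob.map (jumpTimes k)).prod (lebPi (n - r))) := by
    rw [map_jumpTimes, Measure.prod_smul_left]
    refine Integrable.smul_measure ?_ (ENNReal.pow_ne_top (by simp))
    have e : ((lebPi r).restrict (box k)).prod (lebPi (n - r))
        = ((lebPi r).prod (lebPi (n - r))).restrict (box k ×ˢ univ) := by
      rw [← Measure.prod_restrict, Measure.restrict_univ]
    rw [e]
    exact h1.restrict
  exact (measurePreserving_jumpTimes_prod n k).integrable_comp_of_integrable h2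

end JumpGlue

/-! ### Box decomposition of the explicit formula. -/

lemma ae_ne_even {n : ℕ} : ∀ᵐ x ∂(lebPi n), ∀ i, ∀ j : ℕ, x i ≠ 2 * (j : ℝ) :=
  ae_all_iff.2 fun i => ae_all_iff.2 fun j => Measure.ae_eval_ne (fun _ => leb) i (2 * (j : ℝ))

/-- The closed blocks defining `Delta` overlap only at even integers. Away from these, the closed
block and the half-open block of a coordinate have the same index. -/
lemma injective_of_mem_Delta {n : ℕ} {x : Fin n → ℝ} {c : Fin n → ℕ} (hx : x ∈ Delta n)
    (hc : x ∈ box c) (hne : ∀ i, ∀ j : ℕ, x i ≠ 2 * (j : ℝ)) : Function.Injective c := by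
  obtain ⟨k, hk⟩ := hx
  have : c = k := by
    ext i
    refine eq_of_mem_block (hc i trivial) ⟨(hk i).1, lt_of_le_of_ne (hk i).2 fun h => ?_⟩
    refine hne i (k i + 1) ?_
    push_cast
    linarith
  rw [this]
  exact k.injective

lemma ae_jumpTimes_mem_box {m : ℕ} (k : Fin m ↪ ℕ) : ∀ᵐ ω ∂prob, jumpTimes k ω ∈ box k := by
  refine ae_of_ae_map (measurable_jumpTimes k).aemeasurable ?_
  rw [map_jumpTimes]
  exact Measure.ae_smul_measure (ae_restrict_mem (measurableSet_box k)) _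

lemma ae_mem_iUnion_box (m : ℕ) : ∀ᵐ x ∂(lebPi m), x ∈ ⋃ c : Fin m → ℕ, box c := by
  have h : ∀ᵐ x ∂(lebPi m), ∀ i, 0 ≤ x i :=
    ae_all_iff.2 fun i => Measure.tendsto_eval_ae_ae.eventually
      (ae_restrict_mem (measurableSet_Ici (a := (0 : ℝ))))
  filter_upwards [h] with x hx
  exact mem_iUnion.2 ⟨fun i => ⌊x i / 2⌋₊, fun i _ => (mem_block_iff (hx i)).2 rfl⟩

lemma hasSum_integral_box {m : ℕ} {h : (Fin m → ℝ) → ℝ} (hh : Integrable h (lebPi m)) :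
    HasSum (fun c : Fin m → ℕ => ∫ y in box c, h y ∂(lebPi m)) (∫ y, h y ∂(lebPi m)) := by
  have := hasSum_integral_iUnion (fun c : Fin m → ℕ => measurableSet_box c)
    (fun _ _ h => disjoint_box h) hh.integrableOn
  rwa [Measure.restrict_eq_self_of_ae_mem (ae_mem_iUnion_box m)] at this

lemma injective_coe_embedding (m : ℕ) :
    Function.Injective fun k : Fin m ↪ ℕ => (k : Fin m → ℕ) := DFunLike.coe_injective

/-- A sum over injective tuples, computed by summing first over the last `n - r` entries. -/
lemma tsum_tsum_glue {n r : ℕ} (hr : r ≤ n) {V : (Fin n ↪ ℕ) → ℝ} (hV : Summable V)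
    {T : (Fin r ↪ ℕ) → (Fin (n - r) → ℕ) → ℝ}
    (h1 : ∀ (k : Fin r ↪ ℕ) (m : Fin (n - r) → ℕ) (c : Fin n ↪ ℕ),
      ⇑c = glue n r k m → T k m = V c)
    (h2 : ∀ (k : Fin r ↪ ℕ) (m : Fin (n - r) → ℕ), ¬ Function.Injective (glue n r k m) →
      T k m = 0) :
    ∑' (k : Fin r ↪ ℕ) (m : Fin (n - r) → ℕ), T k m = ∑' c, V c := by
  classical
  -- Extension by zero to all tuples, which form a product under gluing, so that the sum can be
  -- iterated. Tuples whose first r entries repeat contribute nothing.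
  let W : (Fin n → ℕ) → ℝ := fun c => if h : Function.Injective c then V ⟨c, h⟩ else 0
  have hWc : ∀ c : Fin n ↪ ℕ, W c = V c := fun c => dif_pos c.injective
  have hW0 : ∀ c : Fin n → ℕ, ¬ Function.Injective c → W c = 0 := fun c h => dif_neg h
  clear_value W
  have hWsupp : Function.support W ⊆ Set.range fun c : Fin n ↪ ℕ => (c : Fin n → ℕ) :=
    fun c hc => by
      by_cases h : Function.Injective c
      · exact ⟨⟨c, h⟩, rfl⟩
      · exact absurd (hW0 c h) hc
  have hWsum : Summable W := by
    rw [← (injective_coe_embedding n).summable_iff fun c hc => by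
      by_contra h
      exact hc (hWsupp h)]
    exact hV.congr fun c => (hWc c).symm
  have hW1 : ∑' c, W c = ∑' c : Fin n ↪ ℕ, V c := by
    rw [← (injective_coe_embedding n).tsum_eq hWsupp]
    exact tsum_congr hWc
  have hWglue : Summable fun p : (Fin r → ℕ) × (Fin (n - r) → ℕ) => W (glue n r p.1 p.2) :=
    (glueEquiv hr).summable_iff.2 hWsum
  have hWm : ∀ (k : Fin r ↪ ℕ) (m : Fin (n - r) → ℕ), W (glue n r k m) = T k m := fun k m => by
    by_cases h : Function.Injective (glue n r k m)
    · rw [h1 k m ⟨_, h⟩ rfl]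
      exact hWc ⟨_, h⟩
    · rw [h2 k m h, hW0 _ h]
  have hW2 : ∑' c, W c = ∑' (k : Fin r → ℕ) (m : Fin (n - r) → ℕ), W (glue n r k m) := by
    rw [← (glueEquiv hr).tsum_eq]
    exact hWglue.tsum_prod' fun k => hWglue.comp_injective (Prod.mk_right_injective k)
  have hW3 : ∑' (k : Fin r → ℕ) (m : Fin (n - r) → ℕ), W (glue n r k m)
      = ∑' (k : Fin r ↪ ℕ) (m : Fin (n - r) → ℕ), W (glue n r k m) := by
    refine ((injective_coe_embedding r).tsum_eq
      (f := fun k => ∑' m : Fin (n - r) → ℕ, W (glue n r k m)) fun k hk => ?_).symm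
    by_cases h : Function.Injective k
    · exact ⟨⟨k, h⟩, rfl⟩
    · refine absurd ?_ hk
      have : ∀ m : Fin (n - r) → ℕ, W (glue n r k m) = 0 := fun m =>
        hW0 _ fun h' => h (injective_of_glue_injective hr h').1
      simp [this]
  rw [← hW1, hW2, hW3]
  simp only [hWm]

/-- The value of `f` at the jump times `c`, averaged over the coordinates in `A`. -/
def partialAvg {n : ℕ} (f : (Fin n → ℝ) → ℝ) (A : Finset (Fin n)) (c : Fin n ↪ ℕ) : Omega → ℝ :=
  avg (A.map c) fun ω => f (jumpTimes c ω)

/-- The positions from `r` on. -/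
def tail (n r : ℕ) : Finset (Fin n) := {i | r ≤ (i : ℕ)}

lemma card_tail {n r : ℕ} (hr : r ≤ n) : (tail n r).card = n - r := by
  have h1 : tail n r = Finset.univ.map ⟨fun i : Fin (n - r) => splitEquiv hr (Sum.inr i),
      (splitEquiv hr).injective.comp Sum.inr_injective⟩ := by
    ext i
    obtain ⟨j, rfl⟩ := (splitEquiv hr).surjective i
    cases j with
    | inl j => simp [tail, splitEquiv_inl]
    | inr j => simp [tail, splitEquiv_inr]
  rw [h1, Finset.card_map, Finset.card_univ, Fintype.card_fin]

/-- Reading the last n - r jump times from an independent copy is the same as resampling exactly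
their coordinates, since the entries of `c` are distinct. Integrals over y thereby become averages.
-/
lemma glue_jumpTimes {n r : ℕ} (hr : r ≤ n) (c : Fin n ↪ ℕ) {k : Fin r → ℕ}
    {m : Fin (n - r) → ℕ} (hc : ⇑c = glue n r k m) (ω ω' : Omega) :
    glue n r (jumpTimes k ω) (jumpTimes m ω')
      = jumpTimes c (mix ((tail n r).map c) ω ω') := by
  ext i
  obtain ⟨j, rfl⟩ := (splitEquiv hr).surjective i
  cases j with
  | inl j =>
    have h : c (splitEquiv hr (Sum.inl j)) = k j := by rw [hc, glue_inl]
    have h2 : k j ∉ (tail n r).map c := by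
      rw [← h]
      simp [tail, splitEquiv_inl]
    rw [glue_inl, jumpTimes, jumpTimes, mix, h, if_neg h2]
  | inr j =>
    have h : c (splitEquiv hr (Sum.inr j)) = m j := by rw [hc, glue_inr]
    have h2 : m j ∈ (tail n r).map c := by
      rw [← h]
      simp [tail, splitEquiv_inr]
    rw [glue_inr, jumpTimes, jumpTimes, mix, h, if_pos h2]

section Kernel

variable {n : ℕ} {g : (Fin n → ℝ) → ℝ}

/-- On the box, Lebesgue measure is 2^(n-r) times the law of the jump times. This is the source of
the compensating powers of 2 in the definition of the integral. -/
lemma ae_setIntegral_box_of_injective {r : ℕ} (hr : r ≤ n)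
    (hg : Integrable g (lebPi n)) (k : Fin r ↪ ℕ) (m : Fin (n - r) → ℕ) (c : Fin n ↪ ℕ)
    (hc : ⇑c = glue n r k m) :
    ∀ᵐ ω ∂prob, ∫ y in box m, g (glue n r (jumpTimes k ω) y) ∂(lebPi (n - r))
      = 2 ^ (n - r) * partialAvg g (tail n r) c ω := by
  have hm : Function.Injective m :=
    (injective_of_glue_injective hr (hc ▸ c.injective)).2.1
  filter_upwards [(integrable_jumpTimes_glue hr k hg).prod_right_ae] with ω hω
  have h := integral_comp_jumpTimes ⟨m, hm⟩ hω.1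
  simp only [Function.Embedding.coeFn_mk] at h
  rw [partialAvg, avg]
  simp only [← glue_jumpTimes hr c hc]
  rw [h, ← mul_assoc, ← mul_pow]
  norm_num

/-- Up to a null set, the points in question lie outside `Delta`, where the kernel vanishes. -/
lemma ae_setIntegral_box_of_not_injective {r : ℕ} (hr : r ≤ n) (hg : HatL2 n g) (k : Fin r ↪ ℕ)
    (m : Fin (n - r) → ℕ) (hc : ¬ Function.Injective (glue n r k m)) :
    ∀ᵐ ω ∂prob, ∫ y in box m, g (glue n r (jumpTimes k ω) y) ∂(lebPi (n - r)) = 0 := by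
  have h1 := Measure.ae_ae_of_ae_prod ((quasiMeasurePreserving_jumpTimes_glue hr k).ae
    (hg.vanish.and ae_ne_even))
  filter_upwards [h1, ae_jumpTimes_mem_box k] with ω hω hω2
  refine integral_eq_zero_of_ae ?_
  filter_upwards [ae_restrict_of_ae hω, ae_restrict_mem (measurableSet_box m)] with y hy hym
  refine hy.1 fun hD => hc ?_
  exact injective_of_mem_Delta hD (glue_mem_box hr hω2 hym) hy.2

lemma integrable_partialAvg (hg : Integrable g (lebPi n)) (A : Finset (Fin n)) (c : Fin n ↪ ℕ) :
    Integrable (partialAvg g A c) prob :=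
  integrable_avg _ (memLp_one_iff_integrable.1
    (memLp_comp_jumpTimes c (memLp_one_iff_integrable.2 hg)))

lemma integral_abs_partialAvg_le (hg : Integrable g (lebPi n)) (A : Finset (Fin n))
    (c : Fin n ↪ ℕ) :
    ∫ ω, ‖partialAvg g A c ω‖ ∂prob ≤ (1 / 2) ^ n * ∫ x in box c, ‖g x‖ ∂(lebPi n) := by
  have hI : Integrable (fun ω => g (jumpTimes c ω)) prob := memLp_one_iff_integrable.1
    (memLp_comp_jumpTimes c (memLp_one_iff_integrable.2 hg))
  rw [← integral_comp_jumpTimes c hg.norm.1, ← integral_avg (A.map c) hI.norm]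
  refine integral_mono (integrable_partialAvg hg A c).norm (integrable_avg _ hI.norm) fun ω => ?_
  exact norm_integral_le_integral_norm _

/-- Averaging contracts the L¹ norm, and the boxes are disjoint, so the sum of the L¹ norms is at
most 2^(-n) times that of the kernel. -/
lemma ae_summable_partialAvg (hg : Integrable g (lebPi n)) (A : Finset (Fin n)) :
    ∀ᵐ ω ∂prob, Summable fun c : Fin n ↪ ℕ => partialAvg g A c ω := by
  have h := summable_norm_of_tsum_eLpNorm_ne_top (p := 1) le_rfl
    (f := fun c : Fin n ↪ ℕ => partialAvg g A c)
    (fun c => (integrable_partialAvg hg A c).1) (μ := prob) ?_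
  · filter_upwards [h] with ω hω using hω.of_norm
  · have h2 : ∀ c : Fin n ↪ ℕ, eLpNorm (partialAvg g A c) 1 prob
        = ENNReal.ofReal (∫ ω, ‖partialAvg g A c ω‖ ∂prob) := fun c => by
      rw [eLpNorm_one_eq_lintegral_enorm,
        ← ofReal_integral_norm_eq_lintegral_enorm (integrable_partialAvg hg A c)]
    simp only [h2]
    rw [← ENNReal.ofReal_tsum_of_nonneg (fun c => integral_nonneg fun _ => norm_nonneg _)]
    · exact ENNReal.ofReal_ne_top
    · exact Summable.of_nonneg_of_le (fun c => integral_nonneg fun _ => norm_nonneg _)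
        (integral_abs_partialAvg_le hg A) ((hasSum_setIntegral_box hg.norm).summable.mul_left _)

lemma ae_tsum_integral_jumpPoint {r : ℕ} (hr : r ≤ n) (hg : HatL2 n g)
    (hI : Integrable g (lebPi n)) :
    ∀ᵐ ω ∂prob, ∑' k : Fin r ↪ ℕ, ∫ y, g (jumpPoint n r k y ω) ∂(lebPi (n - r))
      = 2 ^ (n - r) * ∑' c : Fin n ↪ ℕ, partialAvg g (tail n r) c ω := by
  classical
  have h1 : ∀ᵐ ω ∂prob, ∀ (k : Fin r ↪ ℕ) (m : Fin (n - r) → ℕ) (c : Fin n ↪ ℕ),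
      ⇑c = glue n r k m → ∫ y in box m, g (glue n r (jumpTimes k ω) y) ∂(lebPi (n - r))
        = 2 ^ (n - r) * partialAvg g (tail n r) c ω := by
    simp only [ae_all_iff]
    exact fun k m c hc => ae_setIntegral_box_of_injective hr hI k m c hc
  have h2 : ∀ᵐ ω ∂prob, ∀ (k : Fin r ↪ ℕ) (m : Fin (n - r) → ℕ),
      ¬ Function.Injective (glue n r k m) →
        ∫ y in box m, g (glue n r (jumpTimes k ω) y) ∂(lebPi (n - r)) = 0 := by
    simp only [ae_all_iff]
    exact fun k m hc => ae_setIntegral_box_of_not_injective hr hg k m hc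
  have h3 : ∀ᵐ ω ∂prob, ∀ k : Fin r ↪ ℕ,
      Integrable (fun y => g (glue n r (jumpTimes k ω) y)) (lebPi (n - r)) := by
    simp only [ae_all_iff]
    exact fun k => (integrable_jumpTimes_glue hr k hI).prod_right_ae
  filter_upwards [h1, h2, h3, ae_summable_partialAvg hI (tail n r)] with ω h1 h2 h3 h4
  have h5 := tsum_tsum_glue hr (h4.mul_left (2 ^ (n - r))) h1 h2
  rw [tsum_mul_left] at h5
  rw [← h5]
  -- By definition, `jumpPoint` is the gluing of the jump times with y.
  exact tsum_congr fun k => (hasSum_integral_box (h3 k)).tsum_eq.symm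

end Kernel

/-! ### The explicit formula and the chaos expansion agree -/

section Kernel

variable {n : ℕ} {g : (Fin n → ℝ) → ℝ}

lemma exists_perm_map_eq {A B : Finset (Fin n)} (h : A.card = B.card) :
    ∃ σ : Equiv.Perm (Fin n), A.map σ.toEmbedding = B := by
  classical
  let e := Finset.equivOfCardEq h
  refine ⟨e.extendSubtype, Finset.eq_of_subset_of_card_le (fun x hx => ?_) (by simp [h])⟩
  rw [Finset.mem_map] at hx
  obtain ⟨y, hy, rfl⟩ := hx
  exact e.extendSubtype_mem y hy

/-- Reindexing of tuples by a permutation. -/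
def permEmbedding (σ : Equiv.Perm (Fin n)) : (Fin n ↪ ℕ) ≃ (Fin n ↪ ℕ) where
  toFun c := σ.toEmbedding.trans c
  invFun c := σ.symm.toEmbedding.trans c
  left_inv c := by ext i; simp
  right_inv c := by ext i; simp

lemma ae_partialAvg_perm (hg : HatL2 n g) (A : Finset (Fin n)) (σ : Equiv.Perm (Fin n))
    (c : Fin n ↪ ℕ) :
    partialAvg g A (permEmbedding σ c) =ᵐ[prob] partialAvg g (A.map σ.toEmbedding) c := by
  have h1 : A.map (permEmbedding σ c) = (A.map σ.toEmbedding).map c := by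
    rw [Finset.map_map]
    rfl
  rw [partialAvg, partialAvg, h1]
  exact avg_congr _ ((quasiMeasurePreserving_jumpTimes c).ae_eq_comp (hg.symm σ))

/-- A permutation of positions carries `A` to `B`. It is absorbed by the symmetry of the kernel and
by reindexing the tuples. -/
lemma ae_tsum_partialAvg_eq_of_card (hg : HatL2 n g) {A B : Finset (Fin n)}
    (h : A.card = B.card) : ∀ᵐ ω ∂prob,
      ∑' c : Fin n ↪ ℕ, partialAvg g A c ω = ∑' c : Fin n ↪ ℕ, partialAvg g B c ω := by
  obtain ⟨σ, rfl⟩ := exists_perm_map_eq h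
  filter_upwards [ae_all_iff.2 fun c => ae_partialAvg_perm hg A σ c] with ω hω
  rw [← (permEmbedding σ).tsum_eq]
  exact tsum_congr hω

/-- The powers of 2 cancel, and the binomial coefficient counts the sets of n - r averaged
positions, all of which give the same sum. What remains is inclusion and exclusion. -/
lemma ae_multIntL1_eq_sum (hg : HatL2 n g) (hI : Integrable g (lebPi n)) :
    ∀ᵐ ω ∂prob, multIntL1 n g ω = ∑ A ∈ (Finset.univ : Finset (Fin n)).powerset,
      (-1 : ℝ) ^ A.card * ∑' c : Fin n ↪ ℕ, partialAvg g A c ω := by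
  have h1 : ∀ᵐ ω ∂prob, ∀ r, r ≤ n →
      ∑' k : Fin r ↪ ℕ, ∫ y, g (jumpPoint n r k y ω) ∂(lebPi (n - r))
        = 2 ^ (n - r) * ∑' c : Fin n ↪ ℕ, partialAvg g (tail n r) c ω := by
    simp only [ae_all_iff]
    exact fun r hr => ae_tsum_integral_jumpPoint hr hg hI
  have h2 : ∀ᵐ ω ∂prob, ∀ A : Finset (Fin n), ∑' c : Fin n ↪ ℕ, partialAvg g A c ω
      = ∑' c : Fin n ↪ ℕ, partialAvg g (tail n (n - A.card)) c ω := by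
    refine ae_all_iff.2 fun A => ae_tsum_partialAvg_eq_of_card hg ?_
    have := Finset.card_le_univ A
    rw [Fintype.card_fin] at this
    rw [card_tail (Nat.sub_le _ _)]
    omega
  filter_upwards [h1, h2] with ω h1 h2
  let Q : ℕ → ℝ := fun s => (-1 : ℝ) ^ s * ∑' c : Fin n ↪ ℕ, partialAvg g (tail n (n - s)) c ω
  have e1 : ∑ A ∈ (Finset.univ : Finset (Fin n)).powerset,
      (-1 : ℝ) ^ A.card * ∑' c : Fin n ↪ ℕ, partialAvg g A c ω
      = ∑ A ∈ (Finset.univ : Finset (Fin n)).powerset, Q A.card :=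
    Finset.sum_congr rfl fun A _ => by rw [h2 A]
  rw [e1, Finset.sum_powerset_apply_card, Finset.card_univ, Fintype.card_fin, ← Finset.sum_flip]
  refine Finset.sum_congr rfl fun r hr => ?_
  have hr : r ≤ n := by simpa [Nat.lt_succ_iff] using hr
  rw [h1 r hr, Nat.choose_symm hr, nsmul_eq_mul]
  simp only [Q, Nat.sub_sub_self hr]
  field_simp

/-- The summand of the multiple stochastic integral attached to a tuple, as a function. -/
def chaosFun (g : (Fin n → ℝ) → ℝ) (c : Fin n ↪ ℕ) (ω : Omega) : ℝ :=
  ∑ A ∈ (Finset.univ : Finset (Fin n)).powerset, (-1 : ℝ) ^ A.card * partialAvg g A c ω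

lemma ae_hasSum_chaosFun (hg : HatL2 n g) (hI : Integrable g (lebPi n)) :
    ∀ᵐ ω ∂prob, HasSum (fun c => chaosFun g c ω) (multIntL1 n g ω) := by
  have h : ∀ᵐ ω ∂prob, ∀ A : Finset (Fin n), Summable fun c : Fin n ↪ ℕ => partialAvg g A c ω :=
    ae_all_iff.2 fun A => ae_summable_partialAvg hI A
  filter_upwards [ae_multIntL1_eq_sum hg hI, h] with ω h1 h2
  rw [h1]
  exact hasSum_sum fun A _ => (h2 A).hasSum.mul_left _

lemma chaosTerm_toLp (hg : MemLp g 2 (lebPi n)) (c : Fin n ↪ ℕ) :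
    chaosTerm c hg.toLp =ᵐ[prob] chaosFun g c := by
  have hF := memLp_comp_jumpTimes c hg
  have h1 : chaosTerm c hg.toLp = ∑ A ∈ (Finset.univ : Finset (Fin n)).powerset,
      ((-1 : ℝ) ^ A.card) • (memLp_avg (A.map c) hF).toLp := by
    rw [chaosTerm, LinearMap.comp_apply, evalJump_toLp, hoeffding_apply, indices,
      Finset.map_eq_image, Finset.powerset_image,
      Finset.sum_image (Finset.image_injective c.injective).injOn]
    refine Finset.sum_congr rfl fun A _ => ?_
    rw [Finset.card_image_of_injective _ c.injective, avgL_toLp]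
    simp only [Finset.map_eq_image]
  rw [h1]
  refine (Lp.coeFn_finsetSum _ _).trans ?_
  have h2 : ∀ᵐ ω ∂prob, ∀ A : Finset (Fin n),
      (((-1 : ℝ) ^ A.card) • (memLp_avg (A.map c) hF).toLp : Lp ℝ 2 prob) ω
        = (-1 : ℝ) ^ A.card * partialAvg g A c ω := by
    refine ae_all_iff.2 fun A => ?_
    filter_upwards [Lp.coeFn_smul ((-1 : ℝ) ^ A.card) ((memLp_avg (A.map c) hF).toLp),
      (memLp_avg (A.map c) hF).coeFn_toLp] with ω h3 h4
    rw [h3, Pi.smul_apply, h4, smul_eq_mul]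
    rfl
  filter_upwards [h2] with ω h2
  rw [Finset.sum_apply, chaosFun]
  exact Finset.sum_congr rfl fun A _ => h2 A

/-- The same series converges almost surely to the explicit formula and in L² to the operator. Both
modes imply convergence in measure, where limits are unique. -/
theorem multIntL1_ae_eq (hg : HatL2 n g) (hI : Integrable g (lebPi n)) :
    multIntL1 n g =ᵐ[prob] multIntL n hg.memLp.toLp := by
  -- Almost sure convergence gives convergence in measure along sequences, so the net of finite sets
  -- is replaced by a cofinal sequence; the index set is countable.
  obtain ⟨s, hs⟩ := Filter.exists_seq_tendsto (atTop : Filter (Finset (Fin n ↪ ℕ)))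
  let S : ℕ → Lp ℝ 2 prob := fun N => ∑ c ∈ s N, chaosTerm c hg.memLp.toLp
  have h1 : Tendsto S atTop (𝓝 (multIntL n hg.memLp.toLp)) :=
    (hasSum_multIntL hg.memLp.toLp).comp hs
  have h2 : TendstoInMeasure prob (fun N => ⇑(S N)) atTop (multIntL n hg.memLp.toLp) :=
    tendstoInMeasure_of_tendsto_Lp h1
  have h3 : ∀ᵐ ω ∂prob, ∀ N, S N ω = ∑ c ∈ s N, chaosFun g c ω := by
    refine ae_all_iff.2 fun N => ?_
    filter_upwards [Lp.coeFn_finsetSum (s N) fun c => chaosTerm c hg.memLp.toLp,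
      ae_all_iff.2 fun c => chaosTerm_toLp hg.memLp c] with ω h4 h5
    rw [h4, Finset.sum_apply]
    exact Finset.sum_congr rfl fun c _ => h5 c
  have h4 : TendstoInMeasure prob (fun N => ⇑(S N)) atTop (multIntL1 n g) := by
    refine tendstoInMeasure_of_tendsto_ae (fun N => Lp.aestronglyMeasurable _) ?_
    filter_upwards [h3, ae_hasSum_chaosFun hg hI] with ω h5 h6
    simp only [h5]
    exact h6.comp hs
  exact tendstoInMeasure_ae_unique h4 h2

end Kernel

/-! ### The extension of the multiple stochastic integral to all square-integrable kernels -/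

section Extension

variable {n : ℕ} {f : (Fin n → ℝ) → ℝ}

/-- The restriction of a kernel to a cube. -/
def truncate (f : (Fin n → ℝ) → ℝ) (m : ℕ) : (Fin n → ℝ) → ℝ :=
  (univ.pi fun _ => Iio (m : ℝ)).indicator f

lemma measurableSet_cube (m : ℕ) : MeasurableSet (univ.pi fun _ : Fin n => Iio (m : ℝ)) :=
  MeasurableSet.univ_pi fun _ => measurableSet_Iio

lemma hatL2_truncate (hf : HatL2 n f) (m : ℕ) : HatL2 n (truncate f m) where
  memLp := hf.memLp.indicator (measurableSet_cube m)
  symm σ := by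
    filter_upwards [hf.symm σ] with x hx
    have : x ∘ σ ∈ (univ.pi fun _ : Fin n => Iio (m : ℝ)) ↔
        x ∈ (univ.pi fun _ : Fin n => Iio (m : ℝ)) := by
      simp only [mem_univ_pi, mem_Iio, Function.comp_apply]
      exact σ.forall_congr_right (q := fun i => x i < (m : ℝ))
    by_cases h : x ∈ (univ.pi fun _ : Fin n => Iio (m : ℝ))
    · rw [truncate, indicator_of_mem h, indicator_of_mem (this.2 h), hx]
    · rw [truncate, indicator_of_notMem h, indicator_of_notMem fun h' => h (this.1 h')]
  vanish := by
    classical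
    filter_upwards [hf.vanish] with x hx hD
    rw [truncate, indicator_apply, hx hD, ite_self]

lemma integrable_truncate (hf : HatL2 n f) (m : ℕ) : Integrable (truncate f m) (lebPi n) := by
  rw [truncate, integrable_indicator_iff (measurableSet_cube m)]
  have : IsFiniteMeasure ((lebPi n).restrict (univ.pi fun _ : Fin n => Iio (m : ℝ))) := by
    refine ⟨?_⟩
    rw [Measure.restrict_apply_univ, lebPi, Measure.pi_pi]
    refine ENNReal.prod_lt_top fun i _ => ?_
    rw [Measure.restrict_apply measurableSet_Iio, Iio_inter_Ici]
    simp
  exact (hf.memLp.restrict _).integrable (by norm_num)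

lemma tendsto_eLpNorm_truncate (hf : HatL2 n f) :
    Tendsto (fun m => eLpNorm (fun x => truncate f m x - f x) 2 (lebPi n)) atTop (𝓝 0) := by
  classical
  have h1 : Tendsto (fun m => ∫ x, (truncate f m x - f x) ^ 2 ∂(lebPi n)) atTop
      (𝓝 (∫ x : Fin n → ℝ, (0 : ℝ) ∂(lebPi n))) := by
    refine tendsto_integral_of_dominated_convergence (fun x => f x ^ 2)
      (fun m => ((hatL2_truncate hf m).memLp.1.sub hf.memLp.1).pow 2) hf.memLp.integrable_sq
      (fun m => ae_of_all _ fun x => ?_) (ae_of_all _ fun x => ?_)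
    · rw [Real.norm_of_nonneg (sq_nonneg _), truncate, indicator_apply]
      split_ifs
      · simpa using sq_nonneg _
      · simp
    · obtain ⟨M, hM⟩ := exists_nat_gt (∑ i, |x i|)
      refine tendsto_const_nhds.congr' ?_
      filter_upwards [eventually_ge_atTop M] with m hm
      have : x ∈ (univ.pi fun _ : Fin n => Iio (m : ℝ)) := fun i _ => by
        have h2 : |x i| ≤ ∑ i, |x i| :=
          Finset.single_le_sum (f := fun i => |x i|) (fun _ _ => abs_nonneg _) (Finset.mem_univ i)
        have h3 : (M : ℝ) ≤ m := by exact_mod_cast hm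
        exact ((le_abs_self _).trans h2).trans_lt (hM.trans_le h3)
      rw [truncate, indicator_of_mem this]
      simp
  rw [integral_zero] at h1
  have h2 := h1.sqrt
  rw [Real.sqrt_zero] at h2
  have h3 := ENNReal.tendsto_ofReal h2
  rw [ENNReal.ofReal_zero] at h3
  refine h3.congr fun m => ?_
  have hm : MemLp (fun x => truncate f m x - f x) 2 (lebPi n) :=
    (hatL2_truncate hf m).memLp.sub hf.memLp
  rw [← ENNReal.ofReal_toReal hm.2.ne, ← Lp.norm_toLp _ hm, ← Real.sqrt_sq (norm_nonneg (hm.toLp)),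
    norm_sq_eq_integral]
  congr 2
  refine integral_congr_ae ?_
  filter_upwards [hm.coeFn_toLp] with x hx
  rw [hx]

lemma tendsto_multIntL (hf : HatL2 n f) {g : ℕ → (Fin n → ℝ) → ℝ} (hg : ∀ m, HatL2 n (g m))
    (h : Tendsto (fun m => eLpNorm (fun x => g m x - f x) 2 (lebPi n)) atTop (𝓝 0)) :
    Tendsto (fun m => multIntL n (hg m).memLp.toLp) atTop (𝓝 (multIntL n hf.memLp.toLp)) :=
  (continuous_multIntL.tendsto _).comp
    ((Lp.tendsto_Lp_iff_tendsto_eLpNorm'' g (fun m => (hg m).memLp) f hf.memLp).2 h)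

/-- The versions of the multiple stochastic integral of `f` are the representatives of its image
under the `L²`-operator. -/
theorem isMultInt_iff (hf : HatL2 n f) {X : Omega → ℝ} :
    IsMultInt n f X ↔ X =ᵐ[prob] multIntL n hf.memLp.toLp := by
  constructor
  · rintro ⟨hX, g, hg, hgf, hgX⟩
    have h1 := tendsto_multIntL hf (fun m => (hg m).1) hgf
    have h2 : Tendsto (fun m => multIntL n (hg m).1.memLp.toLp) atTop (𝓝 hX.toLp) := by
      refine (Lp.tendsto_Lp_iff_tendsto_eLpNorm _ X hX).2 (hgX.congr fun m => ?_)
      refine eLpNorm_congr_ae ?_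
      filter_upwards [multIntL1_ae_eq (hg m).1 (hg m).2] with ω hω
      rw [Pi.sub_apply, hω]
    rw [← tendsto_nhds_unique h2 h1]
    exact hX.coeFn_toLp.symm
  · intro hX
    have hXm : MemLp X 2 prob := (Lp.memLp (multIntL n hf.memLp.toLp)).ae_eq hX.symm
    -- The cubes are invariant under permutations and meet the orthant in finite measure, so the
    -- truncations keep the symmetry and become integrable.
    refine ⟨hXm, truncate f, fun m => ⟨hatL2_truncate hf m, integrable_truncate hf m⟩,
      tendsto_eLpNorm_truncate hf, ?_⟩
    have h1 := tendsto_multIntL hf (hatL2_truncate hf) (tendsto_eLpNorm_truncate hf)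
    refine ((Lp.tendsto_Lp_iff_tendsto_eLpNorm' _ _).1 h1).congr fun m => ?_
    refine eLpNorm_congr_ae ?_
    filter_upwards [multIntL1_ae_eq (hatL2_truncate hf m) (integrable_truncate hf m), hX]
      with ω hω hω2
    rw [Pi.sub_apply, hω, hω2]

end Extension

/-! ### Replacing one coordinate -/

lemma mix_singleton (j : ℕ) (ω ω' : Omega) : mix {j} ω ω' = Function.update ω j (ω' j) := by
  ext i
  by_cases h : i = j
  · subst h; simp [mix]
  · simp [mix, h]

lemma measurePreserving_eval_prob (j : ℕ) : MeasurePreserving (fun ω : Omega => ω j) prob unif :=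
  measurePreserving_eval_infinitePi (fun _ : ℕ => unif) j

lemma measurable_update_pair (j : ℕ) :
    Measurable fun p : Omega × ℝ => Function.update p.1 j p.2 := by
  refine measurable_pi_lambda _ fun i => ?_
  by_cases h : i = j
  · subst h
    simpa using measurable_snd
  · simp only [Function.update_of_ne h]
    fun_prop

lemma measurePreserving_update (j : ℕ) :
    MeasurePreserving (fun p : Omega × ℝ => Function.update p.1 j p.2) (prob.prod unif) prob := by
  refine ⟨measurable_update_pair j, ?_⟩
  have h1 : MeasurePreserving (Prod.map id fun ω : Omega => ω j) (prob.prod prob)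
      (prob.prod unif) := (MeasurePreserving.id prob).prod (measurePreserving_eval_prob j)
  rw [← h1.map_eq, Measure.map_map (measurable_update_pair j) h1.measurable,
    show (fun p : Omega × ℝ => Function.update p.1 j p.2) ∘ (Prod.map id fun ω : Omega => ω j)
      = fun p => mix {j} p.1 p.2 from funext fun p => (mix_singleton j p.1 p.2).symm]
  exact (measurePreserving_mix {j}).map_eq

/-- The average of `X` over the coordinate `j`. -/
def coordAvg (X : Omega → ℝ) (j : ℕ) (ω : Omega) : ℝ := ∫ u, X (Function.update ω j u) ∂unif

/-- The centred dependence of `X` on the coordinate `j`. -/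
def coordDiff (X : Omega → ℝ) (j : ℕ) (ω : Omega) (u : ℝ) : ℝ :=
  X (Function.update ω j u) - coordAvg X j ω

lemma coordAvg_update (X : Omega → ℝ) (j : ℕ) (ω : Omega) (v : ℝ) :
    coordAvg X j (Function.update ω j v) = coordAvg X j ω := by
  simp [coordAvg]

lemma avg_singleton {X : Omega → ℝ} (hX : Measurable X) (j : ℕ) : avg {j} X = coordAvg X j := by
  ext ω
  simp only [avg, mix_singleton, coordAvg]
  exact integral_comp_of_measurePreserving (measurePreserving_eval_prob j)
    (F := fun u => X (Function.update ω j u))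
    (hX.comp (measurable_update ω)).aestronglyMeasurable

lemma measurable_coordAvg {X : Omega → ℝ} (hX : Measurable X) (j : ℕ) :
    Measurable (coordAvg X j) :=
  (StronglyMeasurable.integral_prod_right (f := fun ω u => X (Function.update ω j u)) (ν := unif)
    (hX.comp (measurable_update_pair j)).stronglyMeasurable).measurable

lemma measurable_coordDiff {X : Omega → ℝ} (hX : Measurable X) (j : ℕ) :
    Measurable fun p : Omega × ℝ => coordDiff X j p.1 p.2 :=
  (hX.comp (measurable_update_pair j)).sub ((measurable_coordAvg hX j).comp measurable_fst)

/-- Expanding the square for an independent copy, the cross term vanishes because a is centred. No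
third moment is assumed: both sides may be infinite. -/
lemma lintegral_lintegral_mul_sub_sq {Ω : Type*} [MeasurableSpace Ω] {μ : Measure Ω}
    [IsProbabilityMeasure μ] {a : Ω → ℝ} (ha : MemLp a 2 μ) (ha0 : ∫ u, a u ∂μ = 0) :
    ∫⁻ u, ∫⁻ v, ENNReal.ofReal (|a u| * (a u - a v) ^ 2) ∂μ ∂μ
      = ∫⁻ u, ENNReal.ofReal (|a u| ^ 3) ∂μ
        + (∫⁻ u, ENNReal.ofReal |a u| ∂μ) * ∫⁻ u, ENNReal.ofReal (|a u| ^ 2) ∂μ := by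
  have hi := ha.integrable (by norm_num)
  have h2 : ∫⁻ u, ENNReal.ofReal (|a u| ^ 2) ∂μ = ENNReal.ofReal (∫ u, a u ^ 2 ∂μ) := by
    simp only [sq_abs]
    exact (ofReal_integral_eq_lintegral_ofReal ha.integrable_sq
      (ae_of_all _ fun _ => sq_nonneg _)).symm
  have h1 : ∀ u, ∫⁻ v, ENNReal.ofReal (|a u| * (a u - a v) ^ 2) ∂μ
      = ENNReal.ofReal (|a u| ^ 3)
        + ENNReal.ofReal |a u| * ∫⁻ u, ENNReal.ofReal (|a u| ^ 2) ∂μ := fun u => by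
    have hs : MemLp (fun v => a u - a v) 2 μ := (memLp_const (a u)).sub ha
    rw [← ofReal_integral_eq_lintegral_ofReal (hs.integrable_sq.const_mul _)
      (ae_of_all _ fun _ => by positivity), integral_const_mul]
    have e : ∫ v, (a u - a v) ^ 2 ∂μ = a u ^ 2 + ∫ v, a v ^ 2 ∂μ := by
      have e1 : ∀ v, (a u - a v) ^ 2 = a u ^ 2 - 2 * a u * a v + a v ^ 2 := fun v => by ring
      have i1 : Integrable (fun v => a u ^ 2 - 2 * a u * a v) μ :=
        (integrable_const _).sub (hi.const_mul _)
      simp only [e1]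
      rw [integral_add i1 ha.integrable_sq, integral_sub (integrable_const _) (hi.const_mul _), integral_const_mul, ha0]
      simp
    rw [e, h2, ← ENNReal.ofReal_mul (abs_nonneg _), ← ENNReal.ofReal_add (by positivity)
      (mul_nonneg (abs_nonneg _) (integral_nonneg fun _ => sq_nonneg _))]
    congr 1
    rw [mul_add, ← sq_abs (a u)]
    ring
  simp only [h1]
  rw [lintegral_add_left' (hi.1.aemeasurable.abs.pow_const 3).ennreal_ofReal,
    lintegral_mul_const'' _ hi.1.aemeasurable.abs.ennreal_ofReal]

/-! ### Expansion in a single coordinate. -/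

section Coord

variable {X : Omega → ℝ} (hX : Measurable X) (hX2 : MemLp X 2 prob) (j : ℕ)
include hX hX2

lemma memLp_coordAvg : MemLp (coordAvg X j) 2 prob := by
  rw [← avg_singleton hX]
  exact memLp_avg {j} hX2

lemma memLp_coordDiff : MemLp (fun p : Omega × ℝ => coordDiff X j p.1 p.2) 2 (prob.prod unif) :=
  (hX2.comp_measurePreserving (measurePreserving_update j)).sub
    ((memLp_coordAvg hX hX2 j).comp_measurePreserving measurePreserving_fst)

lemma ae_memLp_coordDiff : ∀ᵐ ω ∂prob, MemLp (coordDiff X j ω) 2 unif := by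
  filter_upwards [(memLp_coordDiff hX hX2 j).integrable_sq.prod_right_ae] with ω hω
  exact (memLp_two_iff_integrable_sq ((measurable_coordDiff hX j).comp
    measurable_prodMk_left).aestronglyMeasurable).2 hω

lemma ae_integral_coordDiff : ∀ᵐ ω ∂prob, ∫ u, coordDiff X j ω u ∂unif = 0 := by
  filter_upwards [ae_memLp_coordDiff hX hX2 j] with ω hω
  have h1 : Integrable (fun u => X (Function.update ω j u)) unif := by
    have := (hω.integrable (by norm_num)).add (integrable_const (coordAvg X j ω))
    refine this.congr (ae_of_all _ fun u => ?_)
    simp [coordDiff]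
  simp only [coordDiff]
  rw [integral_sub h1 (integrable_const _)]
  simp [coordAvg]

lemma integral_sq_coordDiff : ∫ ω, ∫ u, coordDiff X j ω u ^ 2 ∂unif ∂prob
    = ∫ ω, (X ω - coordAvg X j ω) ^ 2 ∂prob := by
  rw [← integral_prod _ (memLp_coordDiff hX hX2 j).integrable_sq]
  rw [← integral_comp_of_measurePreserving (measurePreserving_update j)
    (F := fun ω => (X ω - coordAvg X j ω) ^ 2)
    ((hX.sub (measurable_coordAvg hX j)).pow_const 2).aestronglyMeasurable]
  simp only [coordAvg_update, coordDiff]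

/-- The first-order expansion of `E[(X - E_j X) g(X)]`. -/
lemma integral_mul_comp_sub_le {g g1 : ℝ → ℝ} (hg : ∀ x, HasDerivAt g (g1 x) x)
    (hg1 : Continuous g1) (hb : ∀ x, |g1 x| ≤ 1)
    (ht : ∀ x y, |g y - g x - g1 x * (y - x)| ≤ (y - x) ^ 2) (hgX : MemLp (fun ω => g (X ω)) 2 prob) :
    ENNReal.ofReal |(∫ ω, (X ω - coordAvg X j ω) * g (X ω) ∂prob)
        - ∫ ω, g1 (X ω) * ∫ u, coordDiff X j ω u ^ 2 ∂unif ∂prob|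
      ≤ ∫⁻ ω, (∫⁻ u, ENNReal.ofReal (|coordDiff X j ω u| ^ 3) ∂unif
        + (∫⁻ u, ENNReal.ofReal |coordDiff X j ω u| ∂unif)
          * ∫⁻ u, ENNReal.ofReal (|coordDiff X j ω u| ^ 2) ∂unif) ∂prob := by
  have hgm : Measurable g :=
    (continuous_iff_continuousAt.2 fun x => (hg x).continuousAt).measurable
  have ha := memLp_coordDiff hX hX2 j
  have hgu : MemLp (fun p : Omega × ℝ => g (X (Function.update p.1 j p.2))) 2 (prob.prod unif) :=
    hgX.comp_measurePreserving (measurePreserving_update j)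
  have hg0 : MemLp (fun p : Omega × ℝ => g (X p.1)) 2 (prob.prod unif) :=
    hgX.comp_measurePreserving measurePreserving_fst
  have hlin : MemLp (fun p : Omega × ℝ => g1 (X p.1) * (X (Function.update p.1 j p.2) - X p.1)) 2
      (prob.prod unif) := by
    have h0 : MemLp (fun p : Omega × ℝ => X (Function.update p.1 j p.2) - X p.1) 2
        (prob.prod unif) := (hX2.comp_measurePreserving (measurePreserving_update j)).sub
      (hX2.comp_measurePreserving measurePreserving_fst)
    refine h0.mono ((hg1.measurable.comp (hX.comp measurable_fst)).aestronglyMeasurable.mul h0.1)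
      (ae_of_all _ fun p => ?_)
    rw [norm_mul]
    exact mul_le_of_le_one_left (norm_nonneg _) (hb _)
  -- Resampling the coordinate j preserves the law, and `coordAvg` does not see it.
  have e1 : ∫ ω, (X ω - coordAvg X j ω) * g (X ω) ∂prob
      = ∫ p, coordDiff X j p.1 p.2 * g (X (Function.update p.1 j p.2)) ∂(prob.prod unif) := by
    rw [← integral_comp_of_measurePreserving (measurePreserving_update j)
      (F := fun ω => (X ω - coordAvg X j ω) * g (X ω))
      ((hX.sub (measurable_coordAvg hX j)).mul (hgm.comp hX)).aestronglyMeasurable]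
    simp only [coordAvg_update, coordDiff]
  have i1 : Integrable (fun p : Omega × ℝ =>
      coordDiff X j p.1 p.2 * g (X (Function.update p.1 j p.2))) (prob.prod unif) :=
    ha.integrable_mul hgu
  have i2 : Integrable (fun p : Omega × ℝ => coordDiff X j p.1 p.2 * g (X p.1)) (prob.prod unif) :=
    ha.integrable_mul hg0
  have i3 : Integrable (fun p : Omega × ℝ => coordDiff X j p.1 p.2
      * (g1 (X p.1) * (X (Function.update p.1 j p.2) - X p.1))) (prob.prod unif) :=
    ha.integrable_mul hlin
  have i4 : Integrable (fun p : Omega × ℝ =>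
      coordDiff X j p.1 p.2 * g (X (Function.update p.1 j p.2))
        - coordDiff X j p.1 p.2 * g (X p.1)) (prob.prod unif) := i1.sub i2
  -- Here g(X) does not involve the resampled value, while `coordDiff` is centred in it. This zero
  -- term can be subtracted freely.
  have e2 : ∫ p, coordDiff X j p.1 p.2 * g (X p.1) ∂(prob.prod unif) = 0 := by
    rw [integral_prod _ i2]
    refine integral_eq_zero_of_ae ?_
    filter_upwards [ae_integral_coordDiff hX hX2 j] with ω hω
    simp only [integral_mul_const, hω, zero_mul, Pi.zero_apply]
  -- The increment of X is `coordDiff` at u minus a quantity independent of u, which drops out by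
  -- centring.
  have e3 : ∫ p, coordDiff X j p.1 p.2
        * (g1 (X p.1) * (X (Function.update p.1 j p.2) - X p.1)) ∂(prob.prod unif)
      = ∫ ω, g1 (X ω) * ∫ u, coordDiff X j ω u ^ 2 ∂unif ∂prob := by
    rw [integral_prod _ i3]
    refine integral_congr_ae ?_
    filter_upwards [ae_integral_coordDiff hX hX2 j, ae_memLp_coordDiff hX hX2 j] with ω h1 h2
    have e : ∀ u, coordDiff X j ω u * (g1 (X ω) * (X (Function.update ω j u) - X ω))
        = g1 (X ω) * (coordDiff X j ω u ^ 2 - (X ω - coordAvg X j ω) * coordDiff X j ω u) :=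
      fun u => by simp only [coordDiff]; ring
    simp only [e]
    rw [integral_const_mul, integral_sub h2.integrable_sq
      ((h2.integrable (by norm_num)).const_mul _), integral_const_mul, h1]
    simp
  have e4 : (∫ ω, (X ω - coordAvg X j ω) * g (X ω) ∂prob)
        - ∫ ω, g1 (X ω) * ∫ u, coordDiff X j ω u ^ 2 ∂unif ∂prob
      = ∫ p, coordDiff X j p.1 p.2 * (g (X (Function.update p.1 j p.2)) - g (X p.1)
          - g1 (X p.1) * (X (Function.update p.1 j p.2) - X p.1)) ∂(prob.prod unif) := by
    simp only [mul_sub (coordDiff X j _ _)]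
    rw [integral_sub i4 i3, integral_sub i1 i2, e1, e2, e3, sub_zero]
  have hΦ : Measurable fun p : Omega × ℝ => ENNReal.ofReal (|coordDiff X j p.1 p.2|
      * (coordDiff X j p.1 p.2 - (X p.1 - coordAvg X j p.1)) ^ 2) := by
    have := measurable_coordDiff hX j
    have := measurable_coordAvg hX j
    fun_prop
  calc _ ≤ ∫⁻ p, ENNReal.ofReal (|coordDiff X j p.1 p.2|
        * (coordDiff X j p.1 p.2 - (X p.1 - coordAvg X j p.1)) ^ 2) ∂(prob.prod unif) := by
        rw [e4, ← Real.norm_eq_abs, ofReal_norm]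
        refine (enorm_integral_le_lintegral_enorm _).trans (lintegral_mono fun p => ?_)
        rw [← ofReal_norm, Real.norm_eq_abs, abs_mul]
        refine ENNReal.ofReal_le_ofReal (mul_le_mul_of_nonneg_left ((ht _ _).trans ?_)
          (abs_nonneg _))
        simp only [coordDiff]
        ring_nf
        exact le_rfl
    _ = ∫⁻ ω, ∫⁻ u, ENNReal.ofReal (|coordDiff X j ω u|
        * (coordDiff X j ω u - (X ω - coordAvg X j ω)) ^ 2) ∂unif ∂prob :=
        lintegral_prod _ hΦ.aemeasurable
    -- The original value of the coordinate j is resampled too, as v. The increment becomes a(u) -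
    -- a(v) with u and v independent.
    _ = ∫⁻ ω, ∫⁻ v, ∫⁻ u, ENNReal.ofReal (|coordDiff X j ω u|
        * (coordDiff X j ω u - coordDiff X j ω v) ^ 2) ∂unif ∂unif ∂prob := by
        rw [← (measurePreserving_update j).lintegral_comp hΦ.lintegral_prod_right',
          lintegral_prod]
        · simp only [coordAvg_update, coordDiff, Function.update_idem]
        · exact (hΦ.lintegral_prod_right'.comp (measurable_update_pair j)).aemeasurable
    _ = _ := by
        refine lintegral_congr_ae ?_
        filter_upwards [ae_integral_coordDiff hX hX2 j, ae_memLp_coordDiff hX hX2 j] with ω h1 h2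
        rw [← lintegral_lintegral_mul_sub_sq h2 h1, lintegral_lintegral_swap]
        have h3 : Measurable (coordDiff X j ω) :=
          (measurable_coordDiff hX j).comp measurable_prodMk_left
        refine Measurable.aemeasurable ?_
        simp only [Function.uncurry_def]
        fun_prop

end Coord

/-! ### The Malliavin–Stein bound in a fixed chaos -/

/-- The conditional variance of `X` given all coordinates but the one of index `j`. -/
def coordVar (X : Omega → ℝ) (j : ℕ) (ω : Omega) : ℝ := ∫ u, coordDiff X j ω u ^ 2 ∂unif

/-- The remainder in the first-order expansion of a function of `X` in the coordinate `j`. -/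
def coordRem (X : Omega → ℝ) (j : ℕ) (ω : Omega) : ℝ≥0∞ :=
  ∫⁻ u, ENNReal.ofReal (|coordDiff X j ω u| ^ 3) ∂unif
    + (∫⁻ u, ENNReal.ofReal |coordDiff X j ω u| ∂unif)
      * ∫⁻ u, ENNReal.ofReal (|coordDiff X j ω u| ^ 2) ∂unif

lemma coordVar_nonneg (X : Omega → ℝ) (j : ℕ) (ω : Omega) : 0 ≤ coordVar X j ω :=
  integral_nonneg fun _ => sq_nonneg _

section Chaos

open scoped InnerProductSpace

variable {X : Omega → ℝ} (hX : Measurable X) (hX2 : MemLp X 2 prob)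
include hX hX2

lemma dev_toLp (j : ℕ) : dev avgOne j hX2.toLp
    = (hX2.sub (memLp_coordAvg hX hX2 j)).toLp := by
  rw [dev_apply, avgOne, avgL_toLp, MemLp.toLp_sub hX2 (memLp_coordAvg hX hX2 j)]
  congr 2
  exact avg_singleton hX j

lemma integral_coordVar (j : ℕ) : ∫ ω, coordVar X j ω ∂prob = ‖dev avgOne j hX2.toLp‖ ^ 2 := by
  rw [dev_toLp hX hX2, norm_sq_eq_integral]
  simp only [coordVar]
  rw [integral_sq_coordDiff hX hX2 j]
  refine integral_congr_ae ?_
  filter_upwards [(hX2.sub (memLp_coordAvg hX hX2 j)).coeFn_toLp] with ω hω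
  rw [hω]
  rfl

lemma integrable_coordVar (j : ℕ) : Integrable (coordVar X j) prob :=
  (memLp_coordDiff hX hX2 j).integrable_sq.integral_prod_left

/-- The variable g(E_j X) is fixed by the averaging E_j, hence is no closer to g(X) than the
projection E_j g(X). The Lipschitz bound compares its distance with that of X to E_j X. This
supplies the summability for g(X) that the eigenvalue identity needs. -/
lemma norm_dev_comp_le {g : ℝ → ℝ} (hg : ∀ x y, |g x - g y| ≤ |x - y|)
    (hgX : ∀ Y, Measurable Y → MemLp Y 2 prob → MemLp (fun ω => g (Y ω)) 2 prob) (j : ℕ) :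
    ‖dev avgOne j (hgX X hX hX2).toLp‖ ≤ ‖dev avgOne j hX2.toLp‖ := by
  have hQ := hgX _ (measurable_coordAvg hX j) (memLp_coordAvg hX hX2 j)
  refine (isProjFamily_avgOne.norm_dev_le_of_fixed j _
    (avgOne_toLp_of_fixed (j := j) hQ fun ω ω' => ?_)).trans ?_
  · rw [← avg_singleton hX, avg_avg_mix]
  · rw [dev_toLp hX hX2, ← MemLp.toLp_sub]
    refine Lp.norm_le_norm_of_ae_le ?_
    filter_upwards [((hgX X hX hX2).sub hQ).coeFn_toLp,
      (hX2.sub (memLp_coordAvg hX hX2 j)).coeFn_toLp] with ω h1 h2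
    rw [h1, h2]
    exact hg _ _

variable {n : ℕ} (hch : hX2.toLp ∈ (finChaos avgOne n).topologicalClosure)
include hch

lemma summable_integral_coordVar : Summable fun j => ∫ ω, coordVar X j ω ∂prob := by
  simp only [integral_coordVar hX hX2]
  exact isProjFamily_avgOne.summable_norm_dev_sq hch

lemma tsum_lintegral_coordVar_ne_top :
    ∑' j, ∫⁻ ω, ENNReal.ofReal (coordVar X j ω) ∂prob ≠ ∞ := by
  have h : ∀ j, ∫⁻ ω, ENNReal.ofReal (coordVar X j ω) ∂prob
      = ENNReal.ofReal (∫ ω, coordVar X j ω ∂prob) := fun j =>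
    (ofReal_integral_eq_lintegral_ofReal (integrable_coordVar hX hX2 j)
      (ae_of_all _ (coordVar_nonneg X j))).symm
  simp only [h]
  rw [← ENNReal.ofReal_tsum_of_nonneg (fun j => integral_nonneg (coordVar_nonneg X j))
    (summable_integral_coordVar hX hX2 hch)]
  exact ENNReal.ofReal_ne_top

lemma ae_summable_coordVar : ∀ᵐ ω ∂prob, Summable fun j => coordVar X j ω := by
  have h := summable_norm_of_tsum_eLpNorm_ne_top (p := 1) le_rfl
    (f := fun j => coordVar X j) (fun j => (integrable_coordVar hX hX2 j).1) (μ := prob) ?_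
  · filter_upwards [h] with ω hω using hω.of_norm
  · simp only [eLpNorm_one_eq_lintegral_enorm, Real.enorm_of_nonneg (coordVar_nonneg X _ _)]
    exact tsum_lintegral_coordVar_ne_top hX hX2 hch

lemma integrable_tsum_coordVar : Integrable (fun ω => ∑' j, coordVar X j ω) prob := by
  have hm : ∀ j, AEMeasurable (fun ω => ENNReal.ofReal (coordVar X j ω)) prob := fun j =>
    (integrable_coordVar hX hX2 j).1.aemeasurable.ennreal_ofReal
  have h : Integrable (fun ω => (∑' j, ENNReal.ofReal (coordVar X j ω)).toReal) prob := by
    refine integrable_toReal_of_lintegral_ne_top (AEMeasurable.tsum hm) ?_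
    rw [lintegral_tsum hm]
    exact tsum_lintegral_coordVar_ne_top hX hX2 hch
  refine h.congr ?_
  filter_upwards [ae_summable_coordVar hX hX2 hch] with ω hω
  rw [← ENNReal.ofReal_tsum_of_nonneg (fun j => coordVar_nonneg X j ω) hω,
    ENNReal.toReal_ofReal (tsum_nonneg fun j => coordVar_nonneg X j ω)]

/-- The bound behind the Malliavin–Stein inequality, for a solution of Stein's equation. -/
lemma abs_integral_stein_le (hn : 1 ≤ n) {g g1 : ℝ → ℝ} (hg : ∀ x, HasDerivAt g (g1 x) x)
    (hg1 : Continuous g1) (hb : ∀ x, |g1 x| ≤ 1)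
    (ht : ∀ x y, |g y - g x - g1 x * (y - x)| ≤ (y - x) ^ 2) :
    ENNReal.ofReal |∫ ω, (g1 (X ω) - X ω * g (X ω)) ∂prob|
      ≤ (∫⁻ ω, ENNReal.ofReal ((1 - 1 / (n : ℝ) * ∑' j, coordVar X j ω) ^ 2) ∂prob) ^ (1 / 2 : ℝ)
        + ENNReal.ofReal (1 / (n : ℝ)) * ∑' j, ∫⁻ ω, coordRem X j ω ∂prob := by
  have hn0 : (0 : ℝ) < n := by exact_mod_cast hn
  have hglip := abs_sub_le_of_hasDerivAt hg hb
  have hgm : Measurable g :=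
    (continuous_iff_continuousAt.2 fun x => (hg x).continuousAt).measurable
  have hgX : ∀ Y, Measurable Y → MemLp Y 2 prob → MemLp (fun ω => g (Y ω)) 2 prob :=
    fun Y hY hY2 => by
      have h1 : MemLp (fun ω => |g 0| + |Y ω|) 2 prob := (memLp_const |g 0|).add hY2.abs
      refine h1.mono (hgm.comp hY).aestronglyMeasurable (ae_of_all _ fun ω => ?_)
      rw [Real.norm_eq_abs, Real.norm_eq_abs, abs_of_nonneg (a := |g 0| + |Y ω|) (by positivity)]
      have := hglip (Y ω) 0
      rw [sub_zero] at this
      linarith [abs_sub_abs_le_abs_sub (g (Y ω)) (g 0)]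
  have hY := hgX X hX hX2
  let δ : ℕ → ℝ := fun j => (∫ ω, (X ω - coordAvg X j ω) * g (X ω) ∂prob)
    - ∫ ω, g1 (X ω) * coordVar X j ω ∂prob
  have hδ : ∀ j, ‖δ j‖ₑ ≤ ∫⁻ ω, coordRem X j ω ∂prob := fun j => by
    rw [← ofReal_norm, Real.norm_eq_abs]
    exact integral_mul_comp_sub_le hX hX2 j hg hg1 hb ht hY
  -- the eigenvalue equation
  have hsum1 : HasSum (fun j => ∫ ω, (X ω - coordAvg X j ω) * g (X ω) ∂prob)
      (n * ∫ ω, X ω * g (X ω) ∂prob) := by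
    have hs : Summable fun j => ‖dev avgOne j hY.toLp‖ ^ 2 :=
      Summable.of_nonneg_of_le (fun _ => by positivity)
        (fun j => pow_le_pow_left₀ (norm_nonneg _) (norm_dev_comp_le hX hX2 hglip hgX j) 2)
        (isProjFamily_avgOne.summable_norm_dev_sq hch)
    have h := isProjFamily_avgOne.hasSum_inner_dev hch hs
    convert h using 1
    · ext j
      rw [dev_toLp hX hX2, inner_eq_integral]
      refine integral_congr_ae ?_
      filter_upwards [(hX2.sub (memLp_coordAvg hX hX2 j)).coeFn_toLp, hY.coeFn_toLp] with ω h1 h2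
      rw [h1, h2]
      rfl
    · rw [inner_eq_integral]
      congr 1
      refine integral_congr_ae ?_
      filter_upwards [hX2.coeFn_toLp, hY.coeFn_toLp] with ω h1 h2
      rw [h1, h2]
  have hg1X : AEStronglyMeasurable (fun ω => g1 (X ω)) prob :=
    (hg1.measurable.comp hX).aestronglyMeasurable
  have hint : ∀ j, Integrable (fun ω => g1 (X ω) * coordVar X j ω) prob := fun j =>
    (integrable_coordVar hX hX2 j).bdd_mul hg1X (ae_of_all _ fun ω => hb (X ω))
  have hsum2 : HasSum (fun j => ∫ ω, g1 (X ω) * coordVar X j ω ∂prob)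
      (∫ ω, g1 (X ω) * ∑' j, coordVar X j ω ∂prob) := by
    have h := hasSum_integral_of_summable_integral_norm hint ?_
    · simpa only [tsum_mul_left] using h
    · refine Summable.of_nonneg_of_le (fun j => integral_nonneg fun _ => norm_nonneg _)
        (fun j => ?_) (summable_integral_coordVar hX hX2 hch)
      refine integral_mono (hint j).norm (integrable_coordVar hX hX2 j) fun ω => ?_
      simp only [norm_mul, Real.norm_of_nonneg (coordVar_nonneg X j ω)]
      exact mul_le_of_le_one_left (coordVar_nonneg X j ω) (hb _)
  have hV : Integrable (fun ω => ∑' j, coordVar X j ω) prob :=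
    integrable_tsum_coordVar hX hX2 hch
  have hg1V : Integrable (fun ω => g1 (X ω) * ∑' j, coordVar X j ω) prob :=
    hV.bdd_mul hg1X (ae_of_all _ fun ω => hb (X ω))
  have hg1i : Integrable (fun ω => g1 (X ω)) prob :=
    (integrable_const (1 : ℝ)).mono' hg1X (ae_of_all _ fun ω => hb (X ω))
  have hXg : Integrable (fun ω => X ω * g (X ω)) prob := hX2.integrable_mul hY
  have hδsum : HasSum δ (n * (∫ ω, X ω * g (X ω) ∂prob)
      - ∫ ω, g1 (X ω) * ∑' j, coordVar X j ω ∂prob) := hsum1.sub hsum2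
  have hδe : ‖∑' j, δ j‖ₑ ≤ ∑' j, ∫⁻ ω, coordRem X j ω ∂prob :=
    enorm_tsum_le_tsum_enorm.trans (ENNReal.tsum_le_tsum hδ)
  -- Substitution of n E[X g(X)] = Σ_j δ_j + E[g'(X) Σ_j V_j], divided by n.
  have hsplit : ∫ ω, (g1 (X ω) - X ω * g (X ω)) ∂prob
      = (∫ ω, g1 (X ω) * (1 - 1 / (n : ℝ) * ∑' j, coordVar X j ω) ∂prob)
        - 1 / (n : ℝ) * ∑' j, δ j := by
    have e : ∀ ω, g1 (X ω) * (1 - 1 / (n : ℝ) * ∑' j, coordVar X j ω)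
        = g1 (X ω) - 1 / (n : ℝ) * (g1 (X ω) * ∑' j, coordVar X j ω) := fun ω => by ring
    simp only [e]
    rw [integral_sub hg1i hXg, integral_sub hg1i (hg1V.const_mul _), integral_const_mul,
      hδsum.tsum_eq]
    field_simp
    ring
  rw [← Real.norm_eq_abs, ofReal_norm, hsplit]
  refine enorm_sub_le.trans (add_le_add ?_ ?_)
  · refine (enorm_integral_le_lintegral_enorm _).trans ?_
    have hw : AEMeasurable (fun ω => 1 - 1 / (n : ℝ) * ∑' j, coordVar X j ω) prob :=
      ((hV.1.aemeasurable).const_mul _).const_sub _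
    have h1 : ∫⁻ ω, ‖g1 (X ω) * (1 - 1 / (n : ℝ) * ∑' j, coordVar X j ω)‖ₑ ∂prob
        ≤ eLpNorm (fun ω => 1 - 1 / (n : ℝ) * ∑' j, coordVar X j ω) 1 prob := by
      rw [eLpNorm_one_eq_lintegral_enorm]
      refine lintegral_mono fun ω => ?_
      rw [enorm_mul]
      refine mul_le_of_le_one_left' ?_
      rw [← ofReal_norm, Real.norm_eq_abs]
      exact ENNReal.ofReal_le_one.2 (hb _)
    refine h1.trans ((eLpNorm_le_eLpNorm_of_exponent_le (by norm_num : (1 : ℝ≥0∞) ≤ 2)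
      hw.aestronglyMeasurable).trans_eq ?_)
    rw [eLpNorm_eq_lintegral_rpow_enorm_toReal (by norm_num) (by norm_num)]
    simp only [ENNReal.toReal_ofNat]
    congr 1
    refine lintegral_congr fun ω => ?_
    rw [← ofReal_norm, Real.norm_eq_abs, ENNReal.ofReal_rpow_of_nonneg (abs_nonneg _) (by norm_num)]
    norm_num
  · rw [enorm_mul, ← ofReal_norm (1 / (n : ℝ)), Real.norm_of_nonneg (by positivity)]
    gcongr

/-- The Malliavin–Stein bound on the Wasserstein distance for an element of the `n`-th chaos. -/
theorem wassersteinDist_le_of_mem_chaos (hn : 1 ≤ n) :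
    wassersteinDist (prob.map X) (gaussianReal 0 1)
      ≤ (∫⁻ ω, ENNReal.ofReal ((1 - 1 / (n : ℝ) * ∑' j, coordVar X j ω) ^ 2) ∂prob) ^ (1 / 2 : ℝ)
        + ENNReal.ofReal (1 / (n : ℝ)) * ∑' j, ∫⁻ ω, coordRem X j ω ∂prob := by
  set R := (∫⁻ ω, ENNReal.ofReal ((1 - 1 / (n : ℝ) * ∑' j, coordVar X j ω) ^ 2) ∂prob)
      ^ (1 / 2 : ℝ) + ENNReal.ofReal (1 / (n : ℝ)) * ∑' j, ∫⁻ ω, coordRem X j ω ∂prob with hR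
  refine iSup₂_le fun h hh => ?_
  have hlip : ∀ x y, |h x - h y| ≤ |x - y| := fun x y => by
    simpa [Real.dist_eq] using hh.dist_le_mul x y
  have hXi : Integrable (fun x : ℝ => x) (prob.map X) :=
    (integrable_map_measure measurable_id.aestronglyMeasurable hX.aemeasurable).2
      (hX2.integrable (by norm_num))
  have hNi : Integrable (fun x : ℝ => x) (gaussianReal 0 1) :=
    (memLp_id_gaussianReal 1).integrable (by simp)
  have : IsProbabilityMeasure (prob.map X) := Measure.isProbabilityMeasure_map hX.aemeasurable
  have hint : ∀ k : ℝ → ℝ, (∀ x y, |k x - k y| ≤ |x - y|) → Continuous k → ∀ μ : Measure ℝ,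
      IsProbabilityMeasure μ → Integrable (fun x : ℝ => x) μ → Integrable k μ :=
    fun k hk hc μ _ hμ => by
      refine ((integrable_const |k 0|).add hμ.abs).mono' hc.aestronglyMeasurable
        (ae_of_all _ fun x => ?_)
      have := hk x 0
      rw [sub_zero] at this
      rw [Real.norm_eq_abs, Pi.add_apply]
      linarith [abs_sub_abs_le_abs_sub (k x) (k 0)]
  refine ENNReal.le_of_forall_pos_le_add fun ε hε _ => ?_
  -- The smoothing error occurs twice, under the law of X and under the normal law, hence ε/2.
  obtain ⟨k, k1, hk, hk1, hkh⟩ := exists_smooth_approx hh (ε := ε / 2) (by positivity)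
  have hklip := abs_sub_le_of_hasDerivAt hk hk1
  have hkc : Continuous k := continuous_iff_continuousAt.2 fun x => (hk x).continuousAt
  obtain ⟨g, g1, hg, hg1, hb, hst, ht⟩ := exists_stein_solution hk hk1
  have hmain := abs_integral_stein_le hX hX2 hch hn hg hg1 hb ht
  have hdiff : ∀ μ : Measure ℝ, IsProbabilityMeasure μ → Integrable (fun x : ℝ => x) μ →
      |(∫ x, h x ∂μ) - ∫ x, k x ∂μ| ≤ ε / 2 := fun μ _ hμ => by
    rw [← integral_sub (hint h hlip hh.continuous μ ‹_› hμ) (hint k hklip hkc μ ‹_› hμ)]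
    refine (norm_integral_le_of_norm_le_const (f := fun x => h x - k x) (C := (ε : ℝ) / 2)
      (ae_of_all μ hkh)).trans_eq ?_
    simp
  have e : ∫ ω, (g1 (X ω) - X ω * g (X ω)) ∂prob
      = (∫ x, k x ∂(prob.map X)) - ∫ x, k x ∂(gaussianReal 0 1) := by
    simp only [hst]
    have hkX : Integrable (fun ω => k (X ω)) prob :=
      (integrable_map_measure hkc.aestronglyMeasurable hX.aemeasurable).1
        (hint k hklip hkc _ inferInstance hXi)
    rw [integral_sub hkX (integrable_const _), integral_map hX.aemeasurable hkc.aestronglyMeasurable]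
    simp
  rw [e] at hmain
  calc ENNReal.ofReal |(∫ x, h x ∂(prob.map X)) - ∫ x, h x ∂(gaussianReal 0 1)|
      ≤ ENNReal.ofReal (|(∫ x, k x ∂(prob.map X)) - ∫ x, k x ∂(gaussianReal 0 1)| + ε) := by
        refine ENNReal.ofReal_le_ofReal ?_
        have h1 := abs_le.1 (hdiff _ inferInstance hXi)
        have h2 := abs_le.1 (hdiff (gaussianReal 0 1) inferInstance hNi)
        have h3 := abs_le.1 (le_refl |(∫ x, k x ∂(prob.map X)) - ∫ x, k x ∂(gaussianReal 0 1)|)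
        rw [abs_le]
        constructor <;> linarith [h1.1, h1.2, h2.1, h2.2, h3.1, h3.2]
    _ ≤ R + ε := by
        rw [ENNReal.ofReal_add (abs_nonneg _) ε.coe_nonneg, ENNReal.ofReal_coe_nnreal]
        gcongr

end Chaos

/-! ### The finite difference operator on a block -/

lemma measurableEmbedding_shift (j : ℕ) :
    MeasurableEmbedding fun u : ℝ => 2 * (j : ℝ) + 1 + u :=
  measurableEmbedding_addLeft (2 * (j : ℝ) + 1)

lemma setLIntegral_block (j : ℕ) (F : ℝ → ℝ≥0∞) :
    ∫⁻ t in block j, F t = 2 * ∫⁻ u, F (2 * (j : ℝ) + 1 + u) ∂unif := by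
  rw [← (measurableEmbedding_shift j).lintegral_map, map_unif, lintegral_smul_measure, smul_eq_mul,
    ← mul_assoc, ENNReal.mul_inv_cancel (by norm_num) (by norm_num), one_mul]

lemma setIntegral_block (j : ℕ) (F : ℝ → ℝ) :
    ∫ t in block j, F t = 2 * ∫ u, F (2 * (j : ℝ) + 1 + u) ∂unif := by
  rw [← (measurableEmbedding_shift j).integral_map, map_unif, integral_smul_measure]
  simp

lemma ae_block (j : ℕ) {p : ℝ → Prop} (h : ∀ᵐ u ∂unif, p (2 * (j : ℝ) + 1 + u)) :
    ∀ᵐ t ∂(volume.restrict (block j)), p t := by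
  rw [← (measurableEmbedding_shift j).ae_map_iff, map_unif] at h
  rw [ae_iff, Measure.smul_apply, smul_eq_mul, mul_eq_zero] at h
  exact ae_iff.2 (h.resolve_left (by simp))

lemma lintegral_leb (F : ℝ → ℝ≥0∞) : ∫⁻ t, F t ∂leb = ∑' j, ∫⁻ t in block j, F t := by
  rw [leb, ← iUnion_block]
  exact lintegral_iUnion measurableSet_block pairwise_disjoint_block F

lemma blockStart_eq {j : ℕ} {t : ℝ} (ht : t ∈ block j) : blockStart t = 2 * (j : ℝ) := by
  rw [blockStart, (mem_block_iff (block_subset_Ici j ht)).1 ht]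

lemma Psi_eq {j : ℕ} {t : ℝ} (ht : t ∈ block j) (ω : Omega) :
    Psi t ω = Function.update ω j (t - 2 * (j : ℝ) - 1) := by
  rw [Psi, blockStart_eq ht, (mem_block_iff (block_subset_Ici j ht)).1 ht]

/-- On the block j the point t corresponds to the value u = t - 2j - 1, and half of Lebesgue measure
on the block to the uniform law; the end point missing from the half-open block is null. -/
lemma nabla_eq {j : ℕ} {t : ℝ} (ht : t ∈ block j) (X : Omega → ℝ) (ω : Omega) :
    nabla X t ω = coordDiff X j ω (t - 2 * (j : ℝ) - 1) := by
  rw [nabla, coordDiff, blockStart_eq ht, Psi_eq ht, coordAvg,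
    intervalIntegral.integral_of_le (by linarith), ← restrict_Ico_eq_restrict_Ioc]
  change _ - 1 / 2 * ∫ s in block j, X (Psi s ω) = _
  rw [setIntegral_congr_fun (g := fun s => X (Function.update ω j (s - 2 * (j : ℝ) - 1)))
    (measurableSet_block j) fun s hs => by simp only [Psi_eq hs], setIntegral_block]
  have : ∀ u : ℝ, 2 * (j : ℝ) + 1 + u - 2 * (j : ℝ) - 1 = u := fun u => by ring
  simp only [this]
  ring

lemma setLIntegral_block_nabla (j : ℕ) (X : Omega → ℝ) (ω : Omega) (Φ : ℝ → ℝ≥0∞) :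
    ∫⁻ t in block j, Φ (nabla X t ω) = 2 * ∫⁻ u, Φ (coordDiff X j ω u) ∂unif := by
  rw [setLIntegral_congr_fun (g := fun t => Φ (coordDiff X j ω (t - 2 * (j : ℝ) - 1)))
    (measurableSet_block j) fun t ht => by simp only [nabla_eq ht], setLIntegral_block]
  have : ∀ u : ℝ, 2 * (j : ℝ) + 1 + u - 2 * (j : ℝ) - 1 = u := fun u => by ring
  simp only [this]

lemma setIntegral_block_nabla_sq (j : ℕ) (X : Omega → ℝ) (ω : Omega) :
    ∫ t in block j, nabla X t ω ^ 2 = 2 * coordVar X j ω := by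
  rw [setIntegral_congr_fun (g := fun t => coordDiff X j ω (t - 2 * (j : ℝ) - 1) ^ 2)
    (measurableSet_block j) fun t ht => by simp only [nabla_eq ht], setIntegral_block, coordVar]
  have : ∀ u : ℝ, 2 * (j : ℝ) + 1 + u - 2 * (j : ℝ) - 1 = u := fun u => by ring
  simp only [this]

/-- Resampling one coordinate preserves the law, so a null set of Ω is hit only for almost no values
of it. Thus ∇ is well defined on almost sure classes. -/
lemma ae_nabla_eq {X Y : Omega → ℝ} (h : X =ᵐ[prob] Y) :
    ∀ᵐ ω ∂prob, ∀ᵐ t ∂leb, nabla X t ω = nabla Y t ω := by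
  have h1 : ∀ᵐ ω ∂prob, ∀ j, ∀ᵐ u ∂unif, X (Function.update ω j u) = Y (Function.update ω j u) :=
    ae_all_iff.2 fun j => Measure.ae_ae_of_ae_prod
      ((measurePreserving_update j).quasiMeasurePreserving.ae h)
  filter_upwards [h1] with ω hω
  rw [leb, ← iUnion_block, ae_restrict_iUnion_iff]
  intro j
  have h2 : ∀ᵐ t ∂(volume.restrict (block j)), coordDiff X j ω (t - 2 * (j : ℝ) - 1)
      = coordDiff Y j ω (t - 2 * (j : ℝ) - 1) := by
    refine ae_block j ?_
    have h3 : coordAvg X j ω = coordAvg Y j ω := integral_congr_ae (hω j)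
    filter_upwards [hω j] with u hu
    have : 2 * (j : ℝ) + 1 + u - 2 * (j : ℝ) - 1 = u := by ring
    rw [this, coordDiff, coordDiff, hu, h3]
  filter_upwards [h2, ae_restrict_mem (measurableSet_block j)] with t ht htj
  rw [nabla_eq htj, nabla_eq htj, ht]

lemma lintegral_nabla_cube (X : Omega → ℝ) (ω : Omega) :
    ∫⁻ t, ENNReal.ofReal (|nabla X t ω| ^ 3) ∂leb
      = ∑' j, 2 * ∫⁻ u, ENNReal.ofReal (|coordDiff X j ω u| ^ 3) ∂unif := by
  rw [lintegral_leb]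
  exact tsum_congr fun j => setLIntegral_block_nabla j X ω fun x => ENNReal.ofReal (|x| ^ 3)

lemma lintegral_nabla_mul {X : Omega → ℝ} (hX : Measurable X) (ω : Omega) :
    ∫⁻ t, ENNReal.ofReal |nabla X t ω| *
        (∫⁻ s in Icc (blockStart t) (blockStart t + 2),
          ENNReal.ofReal (|nabla X s ω| ^ 2)) ∂leb
      = ∑' j, 4 * ((∫⁻ u, ENNReal.ofReal |coordDiff X j ω u| ∂unif)
          * ∫⁻ u, ENNReal.ofReal (|coordDiff X j ω u| ^ 2) ∂unif) := by
  rw [lintegral_leb]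
  refine tsum_congr fun j => ?_
  have hm : Measurable (coordDiff X j ω) :=
    (measurable_coordDiff hX j).comp measurable_prodMk_left
  have h1 : ∀ t ∈ block j, ∫⁻ s in Icc (blockStart t) (blockStart t + 2),
      ENNReal.ofReal (|nabla X s ω| ^ 2)
        = 2 * ∫⁻ u, ENNReal.ofReal (|coordDiff X j ω u| ^ 2) ∂unif := fun t ht => by
    rw [blockStart_eq ht, ← restrict_Ico_eq_restrict_Icc]
    exact setLIntegral_block_nabla j X ω fun x => ENNReal.ofReal (|x| ^ 2)
  rw [setLIntegral_congr_fun (g := fun t => ENNReal.ofReal |nabla X t ω|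
      * (2 * ∫⁻ u, ENNReal.ofReal (|coordDiff X j ω u| ^ 2) ∂unif))
    (measurableSet_block j) fun t ht => by simp only [h1 t ht],
    setLIntegral_block_nabla j X ω fun x => ENNReal.ofReal |x|
      * (2 * ∫⁻ u, ENNReal.ofReal (|coordDiff X j ω u| ^ 2) ∂unif),
    lintegral_mul_const _ (by fun_prop)]
  ring

/-! ### The bound for a measurable element of the chaos. -/

section Final

variable {X : Omega → ℝ} (hX : Measurable X) (hX2 : MemLp X 2 prob)
  {n : ℕ} (hch : hX2.toLp ∈ (finChaos avgOne n).topologicalClosure)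
include hX

lemma aestronglyMeasurable_nabla (ω : Omega) :
    AEStronglyMeasurable (fun t => nabla X t ω) leb := by
  rw [leb, ← iUnion_block, aestronglyMeasurable_iUnion_iff]
  intro j
  have hm : Measurable fun t : ℝ => coordDiff X j ω (t - 2 * (j : ℝ) - 1) :=
    ((measurable_coordDiff hX j).comp measurable_prodMk_left).comp (by fun_prop)
  refine hm.aestronglyMeasurable.congr ?_
  filter_upwards [ae_restrict_mem (measurableSet_block j)] with t ht
  rw [nabla_eq ht]

include hX2 hch

lemma ae_memLp_nabla : ∀ᵐ ω ∂prob, MemLp (fun t => nabla X t ω) 2 leb := by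
  filter_upwards [ae_all_iff.2 fun j => ae_memLp_coordDiff hX hX2 j,
    ae_summable_coordVar hX hX2 hch] with ω h1 h2
  have hm := aestronglyMeasurable_nabla hX ω
  refine (memLp_two_iff_integrable_sq hm).2 ⟨hm.pow 2, ?_⟩
  rw [hasFiniteIntegral_iff_ofReal (ae_of_all _ fun _ => sq_nonneg _), lintegral_leb]
  have h3 : ∀ j, ∫⁻ t in block j, ENNReal.ofReal (nabla X t ω ^ 2)
      = ENNReal.ofReal (2 * coordVar X j ω) := fun j => by
    rw [setLIntegral_block_nabla j X ω fun x => ENNReal.ofReal (x ^ 2), coordVar,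
      ENNReal.ofReal_mul (by norm_num), ofReal_integral_eq_lintegral_ofReal (h1 j).integrable_sq
        (ae_of_all _ fun _ => sq_nonneg _)]
    simp
  simp only [h3]
  rw [← ENNReal.ofReal_tsum_of_nonneg (fun j => mul_nonneg (by norm_num) (coordVar_nonneg X j ω))
    (h2.mul_left 2)]
  exact ENNReal.ofReal_lt_top

lemma ae_integral_nabla_sq : ∀ᵐ ω ∂prob,
    ∫ t, nabla X t ω ^ 2 ∂((1 / 2 : ℝ≥0) • leb) = ∑' j, coordVar X j ω := by
  filter_upwards [ae_memLp_nabla hX hX2 hch] with ω hω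
  have h := hω.integrable_sq
  have h1 : ∫ t, nabla X t ω ^ 2 ∂leb = 2 * ∑' j, coordVar X j ω := by
    have h2 : IntegrableOn (fun t => nabla X t ω ^ 2) (⋃ j, block j) volume := by
      rw [iUnion_block]
      exact h
    rw [leb, ← iUnion_block, integral_iUnion measurableSet_block pairwise_disjoint_block h2,
      ← tsum_mul_left]
    exact tsum_congr fun j => setIntegral_block_nabla_sq j X ω
  rw [integral_smul_nnreal_measure, h1, NNReal.smul_def, smul_eq_mul]
  push_cast
  ring

/-- The Malliavin–Stein bound in terms of the finite difference operator, for a measurable element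
of the `n`-th chaos. -/
theorem wassersteinDist_le_nabla (hn : 1 ≤ n) :
    wassersteinDist (prob.map X) (gaussianReal 0 1) ≤
        (∫⁻ ω, ENNReal.ofReal
            ((1 - 1 / (n : ℝ) * ∫ t, (nabla X t ω) ^ 2 ∂((1 / 2 : ℝ≥0) • leb)) ^ 2)
          ∂prob) ^ (1 / 2 : ℝ)
        + ENNReal.ofReal (1 / (2 * (n : ℝ))) *
          (∫⁻ ω, (∫⁻ t, ENNReal.ofReal (|nabla X t ω| ^ 3) ∂leb) ∂prob)
        + ENNReal.ofReal (1 / (4 * (n : ℝ))) *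
          (∫⁻ ω, (∫⁻ t, ENNReal.ofReal |nabla X t ω| *
              (∫⁻ s in Icc (blockStart t) (blockStart t + 2),
                ENNReal.ofReal (|nabla X s ω| ^ 2)) ∂leb) ∂prob) := by
  have hn0 : (0 : ℝ) < n := by exact_mod_cast hn
  have hm : ∀ p j, Measurable fun ω => ∫⁻ u, ENNReal.ofReal (|coordDiff X j ω u| ^ p) ∂unif :=
    fun p j => Measurable.lintegral_prod_right
      (f := fun ω u => ENNReal.ofReal (|coordDiff X j ω u| ^ p))
      ((measurable_coordDiff hX j).abs.pow_const p).ennreal_ofReal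
  have hm1 : ∀ j, Measurable fun ω => ∫⁻ u, ENNReal.ofReal |coordDiff X j ω u| ∂unif := fun j => by
    simpa only [pow_one] using hm 1 j
  have hm12 : ∀ j, Measurable fun ω => (∫⁻ u, ENNReal.ofReal |coordDiff X j ω u| ∂unif)
      * ∫⁻ u, ENNReal.ofReal (|coordDiff X j ω u| ^ 2) ∂unif := fun j => (hm1 j).mul (hm 2 j)
  refine (wassersteinDist_le_of_mem_chaos hX hX2 hch hn).trans_eq ?_
  rw [add_assoc]
  congr 1
  · congr 1
    refine lintegral_congr_ae ?_
    filter_upwards [ae_integral_nabla_sq hX hX2 hch] with ω hω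
    rw [hω]
  · simp only [lintegral_nabla_cube, lintegral_nabla_mul hX]
    rw [lintegral_tsum fun j => ((hm 3 j).const_mul 2).aemeasurable,
      lintegral_tsum fun j => ((hm12 j).const_mul 4).aemeasurable]
    have e1 : ∀ j, ∫⁻ ω, coordRem X j ω ∂prob
        = ∫⁻ ω, ∫⁻ u, ENNReal.ofReal (|coordDiff X j ω u| ^ 3) ∂unif ∂prob
          + ∫⁻ ω, (∫⁻ u, ENNReal.ofReal |coordDiff X j ω u| ∂unif)
            * ∫⁻ u, ENNReal.ofReal (|coordDiff X j ω u| ^ 2) ∂unif ∂prob := fun j =>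
      lintegral_add_left (hm 3 j) _
    simp only [e1]
    have e2 : ∀ j, ∫⁻ ω, 2 * ∫⁻ u, ENNReal.ofReal (|coordDiff X j ω u| ^ 3) ∂unif ∂prob
        = 2 * ∫⁻ ω, ∫⁻ u, ENNReal.ofReal (|coordDiff X j ω u| ^ 3) ∂unif ∂prob := fun j =>
      lintegral_const_mul _ (hm 3 j)
    have e3 : ∀ j, ∫⁻ ω, 4 * ((∫⁻ u, ENNReal.ofReal |coordDiff X j ω u| ∂unif)
            * ∫⁻ u, ENNReal.ofReal (|coordDiff X j ω u| ^ 2) ∂unif) ∂prob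
        = 4 * ∫⁻ ω, (∫⁻ u, ENNReal.ofReal |coordDiff X j ω u| ∂unif)
            * ∫⁻ u, ENNReal.ofReal (|coordDiff X j ω u| ^ 2) ∂unif ∂prob := fun j =>
      lintegral_const_mul _ (hm12 j)
    simp only [e2, e3]
    rw [ENNReal.tsum_add, ENNReal.tsum_mul_left, ENNReal.tsum_mul_left, mul_add, ← mul_assoc,
      ← mul_assoc]
    -- A single integral over a block is twice an average and a double one four times, so both
    -- remainder terms carry the common factor 1/n.
    have c2 : ENNReal.ofReal (1 / (2 * (n : ℝ))) * 2 = ENNReal.ofReal (1 / (n : ℝ)) := by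
      rw [← ENNReal.ofReal_ofNat, ← ENNReal.ofReal_mul (by positivity)]
      congr 1
      field_simp
    have c4 : ENNReal.ofReal (1 / (4 * (n : ℝ))) * 4 = ENNReal.ofReal (1 / (n : ℝ)) := by
      rw [← ENNReal.ofReal_ofNat, ← ENNReal.ofReal_mul (by positivity)]
      congr 1
      field_simp
    rw [c2, c4]

end Final

end UniformSeq

end

/-! ### The proposition for an arbitrary version of the integral. -/

theorem proposition3p4 (n : ℕ) (hn : 1 ≤ n) (f : (Fin n → ℝ) → ℝ) (hf : UniformSeq.HatL2 n f) :
    -- `I_n(f)` is well defined, as an element of `L²(Ω)`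
    (∃ X : UniformSeq.Omega → ℝ, UniformSeq.IsMultInt n f X) ∧
    (∀ X X' : UniformSeq.Omega → ℝ, UniformSeq.IsMultInt n f X → UniformSeq.IsMultInt n f X' →
      X =ᵐ[UniformSeq.prob] X') ∧
    ∀ X : UniformSeq.Omega → ℝ, UniformSeq.IsMultInt n f X →
      -- `∇ I_n(f)` is almost surely square-integrable, and the bound holds
      (∀ᵐ ω ∂UniformSeq.prob, MemLp (fun t => UniformSeq.nabla X t ω) 2 UniformSeq.leb) ∧
      UniformSeq.wassersteinDist (UniformSeq.prob.map X) (gaussianReal 0 1) ≤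
        (∫⁻ ω, ENNReal.ofReal
            ((1 - 1 / (n : ℝ) * ∫ t, (UniformSeq.nabla X t ω) ^ 2
              ∂((1 / 2 : ℝ≥0) • UniformSeq.leb)) ^ 2)
          ∂UniformSeq.prob) ^ (1 / 2 : ℝ)
        + ENNReal.ofReal (1 / (2 * (n : ℝ))) *
          (∫⁻ ω, (∫⁻ t, ENNReal.ofReal (|UniformSeq.nabla X t ω| ^ 3) ∂UniformSeq.leb)
            ∂UniformSeq.prob)
        + ENNReal.ofReal (1 / (4 * (n : ℝ))) *
          (∫⁻ ω, (∫⁻ t, ENNReal.ofReal |UniformSeq.nabla X t ω| *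
              (∫⁻ s in Icc (UniformSeq.blockStart t) (UniformSeq.blockStart t + 2),
                ENNReal.ofReal (|UniformSeq.nabla X s ω| ^ 2)) ∂UniformSeq.leb)
            ∂UniformSeq.prob) := by
  refine ⟨⟨UniformSeq.multIntL n hf.memLp.toLp, (UniformSeq.isMultInt_iff hf).2 EventuallyEq.rfl⟩,
    fun X X' hX hX' => ((UniformSeq.isMultInt_iff hf).1 hX).trans
      ((UniformSeq.isMultInt_iff hf).1 hX').symm, fun X hX => ?_⟩
  have hae := (UniformSeq.isMultInt_iff hf).1 hX
  -- A version need only be almost everywhere measurable; the bound is proved for a measurable `Y`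
  -- and transferred back.
  obtain ⟨Y, hYm, hXY⟩ := hX.1.1.aemeasurable
  have hY2 : MemLp Y 2 UniformSeq.prob := hX.1.ae_eq hXY
  have hYL : hY2.toLp = UniformSeq.multIntL n hf.memLp.toLp := by
    apply Lp.ext
    filter_upwards [hY2.coeFn_toLp, hXY, hae] with ω h1 h2 h3
    rw [h1, ← h2, h3]
  have hch : hY2.toLp ∈ (UniformSeq.finChaos UniformSeq.avgOne n).topologicalClosure :=
    hYL ▸ UniformSeq.multIntL_mem_closure_finChaos _
  have hnabla := UniformSeq.ae_nabla_eq hXY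
  constructor
  · filter_upwards [UniformSeq.ae_memLp_nabla hYm hY2 hch, hnabla] with ω h1 h2
    exact h1.ae_eq (h2.mono fun t ht => ht.symm)
  · rw [Measure.map_congr hXY]
    refine (UniformSeq.wassersteinDist_le_nabla hYm hY2 hch hn).trans_eq ?_
    congr 1
    · congr 1
      · congr 1
        refine lintegral_congr_ae ?_
        filter_upwards [hnabla] with ω hω
        congr 4
        refine integral_congr_ae ?_
        filter_upwards [Measure.ae_smul_measure hω (1 / 2 : ℝ≥0)] with t ht
        rw [ht]
      · congr 1
        refine lintegral_congr_ae ?_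
        filter_upwards [hnabla] with ω hω
        refine lintegral_congr_ae ?_
        filter_upwards [hω] with t ht
        rw [ht]
    · congr 1
      refine lintegral_congr_ae ?_
      filter_upwards [hnabla] with ω hω
      refine lintegral_congr_ae ?_
      filter_upwards [hω, ae_restrict_mem measurableSet_Ici] with t ht ht0
      -- The inner integral uses Lebesgue measure on ℝ; the block lies in the half-line, where the
      -- almost everywhere equality is known.
      have hsub : Icc (UniformSeq.blockStart t) (UniformSeq.blockStart t + 2) ⊆ Ici (0 : ℝ) :=
        fun s hs => le_trans (by unfold UniformSeq.blockStart; positivity) hs.1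
      rw [ht]
      congr 1
      refine lintegral_congr_ae ?_
      filter_upwards [ae_restrict_of_ae_restrict_of_subset hsub hω] with s hs
      rw [hs]
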